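/- Let $Q$ be a smooth $n$-dimensional manifold (Hausdorff, second countable), let $k\ge 1$, and let $T^{(r)}Q$ denote the tangent bundle of order $r$, i.e. the manifold of classes $[\gamma]_0^{(r)}$ of smooth curves $\gamma:\mathbb R\to Q$ with contact of order $r$ at $0$. A chart $(U,\varphi)$ of $Q$ induces natural coordinates $q^i_{(j)}([\gamma]_0^{(r)})=\frac{d^j}{dt^j}\big|_{t=0}(\varphi^i\circ\gamma)$, $1\le i\le n$, $0\le j\le r$, on the part of $T^{(r)}Q$ over $U$. Let $j_k:T^{(k)}Q\to T(T^{(k-1)}Q)$ be the canonical immersion, which sends $[\gamma]^{(k)}_0$ to the velocity at $t=0$ of the lifted curve $t\mapsto[s\mapsto\gamma(t+s)]^{(k-1)}_0$. For a smooth function $f$ on $T^{(r)}Q$ let $d_Tf$ be the function $x\mapsto\langle df,j_{r+1}(x)\rangle$ on $T^{(r+1)}Q$. Let $L\in C^\infty(T^{(k)}Q)$. In natural coordinates put $$\hat p^{(s)}_i=\sum_{j=0}^{k-1-s}(-1)^j d_T^j\Big(\frac{\partial L}{\partial q^i_{(s+1+j)}}\Big),\qquad 0\le s\le k-1,$$ and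 let the Legendre–Ostrogradsky map $\mathrm{leg}_L:T^{(2k-1)}Q\to T^*T^{(k-1)}Q$ be the map over $T^{(k-1)}Q$ given by $\mathrm{leg}_L=\sum_{s,i}\hat p^{(s)}_i\,dq^i_{(s)}$, and the energy $E_L:T^{(2k-1)}Q\to\mathbb R$ be $E_L=\sum_{s=0}^{k-1}\sum_i q^i_{(s+1)}\hat p^{(s)}_i-L$ (both are independent of the chart). Assume that $L$ is hyperregular, i.e. that $\mathrm{leg}_L$ is a global diffeomorphism. Then the function $H=E_L\circ\mathrm{leg}_L^{-1}$ on $T^*T^{(k-1)}Q$ has the following properties. 1. $H$ is smooth, and in the natural coordinates $(q^i_{(j)},p^{(j)}_i)$, $0\le j\le k-1$, of $T^*T^{(k-1)}Q$ induced by any chart of $Q$, $$H=\sum_{j=0}^{k-2}\sum_i q^i_{(j+1)}p^{(j)}_i+\sum_i\tilde q^{\,i}_{(k)}p^{(k-1)}_i-L\big(q_{(0)},\dots,q_{(k-1)},\tilde q_{(k)}\big),\qquad \tilde q^{\,i}_{(k)}=q^i_{(k)}\circ\mathrm{leg}_L^{-1}.$$ 2. $H$ is a $k$th-order Hamiltonian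 function: its fiber derivative $\mathcal FH:T^*T^{(k-1)}Q\to TT^{(k-1)}Q$ (the derivative of $H$ along the fibers of $T^*T^{(k-1)}Q$, with the identification $(T_x^*)^*\cong T_x$) takes values in the holonomic submanifold $j_k(T^{(k)}Q)$. 3. $H$ is unique: it is the only function on $T^*T^{(k-1)}Q$ with $H\circ\mathrm{leg}_L=E_L$, and also the only function having the local expression in 1 in the natural coordinates induced by the charts of an atlas of $Q$. -/

import Mathlib

open Bundle Set Filter
open scoped Manifold ContDiff Topology

noncomputable section

namespace HigherOrder

section Curves

variable {E : Type*} [NormedAddCommGroup E] [NormedSpace ℝ E]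

theorem jet_comp_congr {f : E → E} {c₁ c₂ : ℝ → E} {r : ℕ}
    (hf : ContDiffAt ℝ ∞ f (c₁ 0)) (h₁ : ContDiffAt ℝ ∞ c₁ 0) (h₂ : ContDiffAt ℝ ∞ c₂ 0)
    (h : ∀ j ≤ r, iteratedDeriv j c₁ 0 = iteratedDeriv j c₂ 0) :
    ∀ j ≤ r, iteratedDeriv j (f ∘ c₁) 0 = iteratedDeriv j (f ∘ c₂) 0 := by
  intro j hj
  have h0 : c₁ 0 = c₂ 0 := by simpa using h 0 (Nat.zero_le _)
  have hj' : ((j : ℕ) : WithTop ℕ∞) ≤ ∞ := by exact_mod_cast le_top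
  rw [iteratedDeriv_vcomp_eq_sum_orderedFinpartition (n := ∞) hf h₁ hj',
    iteratedDeriv_vcomp_eq_sum_orderedFinpartition (n := ∞) (h0 ▸ hf) h₂ hj']
  refine Finset.sum_congr rfl fun c _ => ?_
  rw [h0]
  congr 1
  funext m
  exact h _ ((c.partSize_le m).trans hj)

/-- The polynomial curve `t ↦ ∑ tʲ/j! • vⱼ`. -/
def polyCurve {r : ℕ} (v : Fin (r + 1) → E) (t : ℝ) : E :=
  ∑ j : Fin (r + 1), ((j : ℕ).factorial : ℝ)⁻¹ • t ^ (j : ℕ) • v j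

theorem contDiff_polyCurve (r : ℕ) :
    ContDiff ℝ ∞ (fun p : (Fin (r + 1) → E) × ℝ => polyCurve p.1 p.2) := by
  unfold polyCurve
  fun_prop

theorem contDiff_polyCurve_right {r : ℕ} (v : Fin (r + 1) → E) : ContDiff ℝ ∞ (polyCurve v) := by
  unfold polyCurve
  fun_prop

theorem iteratedDeriv_polyCurve {r : ℕ} (v : Fin (r + 1) → E) (i : Fin (r + 1)) :
    iteratedDeriv i (polyCurve v) 0 = v i := by
  unfold polyCurve
  rw [iteratedDeriv_fun_sum (fun j _ => by fun_prop)]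
  rw [Finset.sum_eq_single i]
  · rw [iteratedDeriv_fun_const_smul_field, iteratedDeriv_smul_const (by fun_prop),
      iteratedDeriv_fun_pow_zero]
    simp [smul_smul, Nat.factorial_ne_zero]
  · intro j _ hj
    rw [iteratedDeriv_fun_const_smul_field, iteratedDeriv_smul_const (by fun_prop),
      iteratedDeriv_fun_pow_zero]
    have : (i : ℕ) ≠ j := fun h => hj (Fin.ext h.symm)
    simp [this]
  · simp

theorem polyCurve_zero {r : ℕ} (v : Fin (r + 1) → E) : polyCurve v 0 = v 0 := by
  simpa using iteratedDeriv_polyCurve v 0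

theorem contDiffOn_iteratedDeriv_param {V : Type*} [NormedAddCommGroup V] [NormedSpace ℝ V]
    {F : V → ℝ → E} {O : Set (V × ℝ)} (hO : IsOpen O)
    (hF : ContDiffOn ℝ ∞ (fun p : V × ℝ => F p.1 p.2) O) (i : ℕ) :
    ContDiffOn ℝ ∞ (fun p : V × ℝ => iteratedDeriv i (F p.1) p.2) O := by
  induction i with
  | zero => simpa using hF
  | succ i ih =>
    have h1 : ContDiffOn ℝ ∞ (fun p : V × ℝ =>
        fderiv ℝ (fun p : V × ℝ => iteratedDeriv i (F p.1) p.2) p ((0 : V), (1 : ℝ))) O :=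
      (ih.fderiv_of_isOpen hO (m := ∞) (by simp)).clm_apply contDiffOn_const
    refine h1.congr fun p hp => ?_
    rw [iteratedDeriv_succ]
    have hd : DifferentiableAt ℝ (fun p : V × ℝ => iteratedDeriv i (F p.1) p.2) p :=
      (ih.contDiffAt (hO.mem_nhds hp)).differentiableAt (by simp)
    have hg : HasDerivAt (fun t : ℝ => (p.1, t)) ((0 : V), (1 : ℝ)) p.2 :=
      (hasDerivAt_const _ _).prodMk (hasDerivAt_id _)
    exact (HasFDerivAt.comp_hasDerivAt (x := p.2) (f := fun t : ℝ => (p.1, t))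
      (l := fun p : V × ℝ => iteratedDeriv i (F p.1) p.2) hd.hasFDerivAt hg).deriv

end Curves

section Jets

variable (E : Type*) [NormedAddCommGroup E] [NormedSpace ℝ E]
  (Q : Type*) [TopologicalSpace Q] [ChartedSpace E Q]

/-- Smooth curves `ℝ → Q`. -/
abbrev SmoothCurve : Type _ := ContMDiffMap 𝓘(ℝ, ℝ) 𝓘(ℝ, E) ℝ Q ∞

variable {E Q}

/-- The translated curve `γ_t (s) = γ (t + s)`. -/
def SmoothCurve.shift (γ : SmoothCurve E Q) (t : ℝ) : SmoothCurve E Q :=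
  ⟨fun s => γ (t + s), γ.contMDiff.comp
    (contDiff_const.add contDiff_id : ContDiff ℝ ∞ fun s : ℝ => t + s).contMDiff⟩

theorem SmoothCurve.shift_zero (γ : SmoothCurve E Q) : γ.shift 0 = γ := by
  ext s
  simp [SmoothCurve.shift]

/-- Contact of order `r` at `t = 0`, tested in some chart. -/
def HasContact (r : ℕ) (γ₁ γ₂ : SmoothCurve E Q) : Prop :=
  γ₁ 0 = γ₂ 0 ∧ ∃ φ ∈ IsManifold.maximalAtlas 𝓘(ℝ, E) ∞ Q, γ₁ 0 ∈ φ.source ∧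
    ∀ j ≤ r, iteratedDeriv j (φ ∘ γ₁) 0 = iteratedDeriv j (φ ∘ γ₂) 0

theorem contDiffAt_chart_comp {φ : OpenPartialHomeomorph Q E}
    (hφ : φ ∈ IsManifold.maximalAtlas 𝓘(ℝ, E) ∞ Q) (γ : SmoothCurve E Q) {t : ℝ}
    (h : γ t ∈ φ.source) : ContDiffAt ℝ ∞ (φ ∘ γ) t := by
  rw [← contMDiffAt_iff_contDiffAt]
  exact (contMDiffAt_of_mem_maximalAtlas hφ h).comp t γ.contMDiff.contMDiffAt

theorem contDiffOn_transition {φ ψ : OpenPartialHomeomorph Q E}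
    (hφ : φ ∈ IsManifold.maximalAtlas 𝓘(ℝ, E) ∞ Q)
    (hψ : ψ ∈ IsManifold.maximalAtlas 𝓘(ℝ, E) ∞ Q) :
    ContDiffOn ℝ ∞ (ψ ∘ φ.symm) (φ.symm ≫ₕ ψ).source := by
  rw [← contMDiffOn_iff_contDiffOn]
  refine (contMDiffOn_of_mem_maximalAtlas hψ).comp
    ((contMDiffOn_symm_of_mem_maximalAtlas hφ).mono ?_) ?_
  · intro x hx; simp at hx; exact hx.1
  · intro x hx; simp at hx; exact hx.2

theorem HasContact.eq_zero {r : ℕ} {γ₁ γ₂ : SmoothCurve E Q} (h : HasContact r γ₁ γ₂) :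
    γ₁ 0 = γ₂ 0 := h.1

theorem HasContact.chart {r : ℕ} {γ₁ γ₂ : SmoothCurve E Q} (h : HasContact r γ₁ γ₂)
    {ψ : OpenPartialHomeomorph Q E} (hψ : ψ ∈ IsManifold.maximalAtlas 𝓘(ℝ, E) ∞ Q)
    (hs : γ₁ 0 ∈ ψ.source) :
    ∀ j ≤ r, iteratedDeriv j (ψ ∘ γ₁) 0 = iteratedDeriv j (ψ ∘ γ₂) 0 := by
  obtain ⟨h0, φ, hφ, hφs, hj⟩ := h
  have key : ∀ γ : SmoothCurve E Q, γ 0 ∈ φ.source →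
      ψ ∘ γ =ᶠ[𝓝 0] (ψ ∘ φ.symm) ∘ (φ ∘ γ) := by
    intro γ hγ
    filter_upwards [γ.contMDiff.continuous.continuousAt.preimage_mem_nhds
      (φ.open_source.mem_nhds hγ)] with t ht
    simp [φ.left_inv ht]
  intro j hjr
  rw [(key γ₁ hφs).iteratedDeriv_eq, (key γ₂ (h0 ▸ hφs)).iteratedDeriv_eq]
  refine jet_comp_congr ?_ (contDiffAt_chart_comp hφ _ hφs)
    (contDiffAt_chart_comp hφ _ (h0 ▸ hφs)) hj j hjr
  refine (contDiffOn_transition hφ hψ).contDiffAt ((φ.symm ≫ₕ ψ).open_source.mem_nhds ?_)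
  simp [hφs, φ.left_inv hφs, hs]

/-- There is a smooth curve in `Q` with prescribed derivatives at `0` in a chart. -/
theorem exists_smoothCurve {φ : OpenPartialHomeomorph Q E}
    (hφ : φ ∈ IsManifold.maximalAtlas 𝓘(ℝ, E) ∞ Q) {r : ℕ} {v : Fin (r + 1) → E} (hv : v 0 ∈ φ.target) :
    ∃ γ : SmoothCurve E Q, γ 0 ∈ φ.source ∧ φ ∘ γ =ᶠ[𝓝 0] polyCurve v := by
  obtain ⟨ε, hε, hball⟩ := Metric.isOpen_iff.1 φ.open_target _ hv
  obtain ⟨δ, hδ, hP⟩ := Metric.continuousAt_iff.1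
    ((contDiff_polyCurve_right v).continuous.continuousAt (x := (0 : ℝ))) ε hε
  let b : ContDiffBump (0 : ℝ) := ⟨δ / 4, δ / 2, by positivity, by linarith⟩
  let c : ℝ → E := fun t => v 0 + b t • (polyCurve v t - v 0)
  have hc : ContDiff ℝ ∞ c :=
    contDiff_const.add (b.contDiff.smul ((contDiff_polyCurve_right v).sub contDiff_const))
  have hmem : ∀ t, c t ∈ φ.target := by
    intro t
    refine hball ?_
    rw [Metric.mem_ball, dist_eq_norm]
    by_cases ht : dist t 0 < δ
    · have h1 := hP ht
      rw [polyCurve_zero, dist_eq_norm] at h1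
      have h2 : ‖c t - v 0‖ ≤ ‖polyCurve v t - v 0‖ := by
        simp only [c, add_sub_cancel_left, norm_smul, Real.norm_eq_abs, abs_of_nonneg b.nonneg]
        exact mul_le_of_le_one_left (norm_nonneg _) b.le_one
      exact h2.trans_lt h1
    · have : b t = 0 := b.zero_of_le_dist (by
        have h4 : b.rOut = δ / 2 := rfl
        rw [h4]; linarith)
      simpa [c, this] using hε
  refine ⟨⟨φ.symm ∘ c, ?_⟩, ?_, ?_⟩
  · exact fun t => (contMDiffAt_symm_of_mem_maximalAtlas hφ (hmem t)).comp t
      hc.contMDiff.contMDiffAt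
  · exact φ.map_target (hmem 0)
  · filter_upwards [b.eventuallyEq_one] with t ht
    have : φ (φ.symm (c t)) = c t := φ.right_inv (hmem t)
    change φ (φ.symm (c t)) = _
    rw [this]
    simp [c, ht]

variable [IsManifold 𝓘(ℝ, E) ∞ Q]

variable (E Q) in
/-- Contact of order `r` is an equivalence relation. -/
def contactSetoid (r : ℕ) : Setoid (SmoothCurve E Q) where
  r := HasContact r
  iseqv :=
    { refl := fun γ => ⟨rfl, chartAt E (γ 0), IsManifold.chart_mem_maximalAtlas _,
        mem_chart_source E _, fun _ _ => rfl⟩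
      symm := fun ⟨h0, φ, hφ, hs, h⟩ => ⟨h0.symm, φ, hφ, h0 ▸ hs, fun j hj => (h j hj).symm⟩
      trans := fun {a b c} hab hbc => by
        obtain ⟨h0, φ, hφ, hs, h⟩ := hab
        exact ⟨h0.trans hbc.1, φ, hφ, hs, fun j hj =>
          (h j hj).trans (hbc.chart hφ (h0 ▸ hs) j hj)⟩ }

variable (E Q) in
/-- The tangent bundle of order `r`, `T^{(r)}Q`: classes `[γ]₀^{(r)}` of smooth curves. -/
def Jet (r : ℕ) : Type _ := Quotient (contactSetoid E Q r)

namespace Jet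

/-- The class `[γ]₀^{(r)}`. -/
def mk (r : ℕ) (γ : SmoothCurve E Q) : Jet E Q r := Quotient.mk _ γ

variable {r : ℕ}

/-- A curve representing a given element of `T^{(r)}Q`. -/
def rep (x : Jet E Q r) : SmoothCurve E Q := Quotient.out x

@[simp] theorem mk_rep (x : Jet E Q r) : mk r x.rep = x := Quotient.out_eq x

theorem mk_eq_mk {γ₁ γ₂ : SmoothCurve E Q} : mk r γ₁ = mk r γ₂ ↔ HasContact r γ₁ γ₂ :=
  Quotient.eq (r := contactSetoid E Q r)

theorem rep_mk (γ : SmoothCurve E Q) : HasContact r (mk r γ).rep γ :=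
  mk_eq_mk.1 (mk_rep _)

/-- The projection `τ_Q^r : T^{(r)}Q → Q`, `[γ] ↦ γ 0`. -/
def base (x : Jet E Q r) : Q :=
  Quotient.lift (s := contactSetoid E Q r) (fun γ => γ 0)
    (fun _ _ h => HasContact.eq_zero h) x

@[simp] theorem base_mk (γ : SmoothCurve E Q) : base (mk r γ) = γ 0 := rfl

theorem rep_zero (x : Jet E Q r) : x.rep 0 = x.base := by
  conv_rhs => rw [← mk_rep x]
  rfl

/-- The natural coordinates `(q_(0), …, q_(r))` of `T^{(r)}Q` induced by a chart `φ` of `Q`: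
`q_(i) [γ] = dⁱ(φ ∘ γ)/dtⁱ (0)`. Each `q_(i)` is `E`-valued, i.e. it collects the coordinates
`q^1_(i), …, q^n_(i)`. -/
def coords (φ : OpenPartialHomeomorph Q E) (x : Jet E Q r) : Fin (r + 1) → E :=
  fun i => iteratedDeriv i (φ ∘ x.rep) 0

theorem coords_mk {φ : OpenPartialHomeomorph Q E}
    (hφ : φ ∈ IsManifold.maximalAtlas 𝓘(ℝ, E) ∞ Q) {γ : SmoothCurve E Q} (h : γ 0 ∈ φ.source)
    (i : Fin (r + 1)) : coords φ (mk r γ) i = iteratedDeriv i (φ ∘ γ) 0 :=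
  (rep_mk γ).chart hφ (by rw [rep_zero]; exact h) i (Nat.lt_succ_iff.1 i.2)

theorem coords_zero (φ : OpenPartialHomeomorph Q E) (x : Jet E Q r) :
    coords φ x 0 = φ x.base := by
  simp [coords, rep_zero]

open Classical in
/-- The inverse of the natural coordinates: the element of `T^{(r)}Q` with natural coordinates `v`
in the chart `φ` (a junk value if there is none). -/
def ofCoords (φ : OpenPartialHomeomorph Q E) (v : Fin (r + 1) → E) : Jet E Q r :=
  if h : ∃ x : Jet E Q r, x.base ∈ φ.source ∧ coords φ x = v then h.choose
  else mk r ⟨fun _ => φ.symm (v 0), contMDiff_const⟩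

theorem eq_of_coords_eq {φ : OpenPartialHomeomorph Q E}
    (hφ : φ ∈ IsManifold.maximalAtlas 𝓘(ℝ, E) ∞ Q) {x y : Jet E Q r} (hx : x.base ∈ φ.source)
    (hy : y.base ∈ φ.source) (h : coords φ x = coords φ y) : x = y := by
  rw [← mk_rep x, ← mk_rep y, mk_eq_mk]
  refine ⟨?_, φ, hφ, by rwa [rep_zero], fun j hj => congrFun h ⟨j, Nat.lt_succ_iff.2 hj⟩⟩
  rw [rep_zero, rep_zero]
  refine φ.injOn hx hy ?_
  rw [← coords_zero φ x, ← coords_zero φ y, h]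

theorem exists_coords_eq {φ : OpenPartialHomeomorph Q E}
    (hφ : φ ∈ IsManifold.maximalAtlas 𝓘(ℝ, E) ∞ Q) {v : Fin (r + 1) → E} (hv : v 0 ∈ φ.target) :
    ∃ x : Jet E Q r, x.base ∈ φ.source ∧ coords φ x = v := by
  obtain ⟨γ, h0, h⟩ := exists_smoothCurve hφ hv
  refine ⟨mk r γ, h0, funext fun i => ?_⟩
  rw [coords_mk hφ h0, h.iteratedDeriv_eq, iteratedDeriv_polyCurve]

theorem ofCoords_spec {φ : OpenPartialHomeomorph Q E}
    (hφ : φ ∈ IsManifold.maximalAtlas 𝓘(ℝ, E) ∞ Q) {v : Fin (r + 1) → E} (hv : v 0 ∈ φ.target) :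
    (ofCoords φ v : Jet E Q r).base ∈ φ.source ∧ coords φ (ofCoords φ v : Jet E Q r) = v := by
  have h := exists_coords_eq hφ hv
  rw [ofCoords, dif_pos h]
  exact h.choose_spec

/-- The natural chart of `T^{(r)}Q` induced by a chart of `Q`. -/
def natChart (r : ℕ) (φ : OpenPartialHomeomorph Q E)
    (hφ : φ ∈ IsManifold.maximalAtlas 𝓘(ℝ, E) ∞ Q) : PartialEquiv (Jet E Q r) (Fin (r + 1) → E) where
  toFun := coords φ
  invFun := ofCoords φ
  source := {x | x.base ∈ φ.source}
  target := {v | v 0 ∈ φ.target}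
  map_source' x hx := by
    change coords φ x 0 ∈ φ.target
    rw [coords_zero]
    exact φ.map_source hx
  map_target' v hv := (ofCoords_spec hφ hv).1
  left_inv' x hx := by
    have h : coords φ x 0 ∈ φ.target := by rw [coords_zero]; exact φ.map_source hx
    exact eq_of_coords_eq hφ (ofCoords_spec hφ h).1 hx (ofCoords_spec hφ h).2
  right_inv' v hv := (ofCoords_spec hφ hv).2

theorem natChart_trans_source {φ ψ : OpenPartialHomeomorph Q E}
    (hφ : φ ∈ IsManifold.maximalAtlas 𝓘(ℝ, E) ∞ Q)
    (hψ : ψ ∈ IsManifold.maximalAtlas 𝓘(ℝ, E) ∞ Q) :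
    ((natChart r φ hφ).symm.trans (natChart r ψ hψ)).source =
      {v | v 0 ∈ (φ.symm ≫ₕ ψ).source} := by
  ext v
  simp only [natChart, PartialEquiv.trans_source, PartialEquiv.symm_source, mem_inter_iff,
    mem_ofPred_eq, mem_preimage, PartialEquiv.coe_symm_mk, OpenPartialHomeomorph.trans_source,
    OpenPartialHomeomorph.symm_toPartialEquiv]
  refine and_congr_right fun hv => ?_
  obtain ⟨h1, h2⟩ := ofCoords_spec (r := r) hφ hv
  have : (ofCoords φ v : Jet E Q r).base = φ.symm (v 0) := by
    rw [← h2, coords_zero, h2, φ.left_inv h1]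
  rw [this]

theorem coords_ofCoords_eq {φ ψ : OpenPartialHomeomorph Q E}
    (hφ : φ ∈ IsManifold.maximalAtlas 𝓘(ℝ, E) ∞ Q)
    (hψ : ψ ∈ IsManifold.maximalAtlas 𝓘(ℝ, E) ∞ Q) {v : Fin (r + 1) → E}
    (hv : v 0 ∈ (φ.symm ≫ₕ ψ).source) (i : Fin (r + 1)) :
    coords ψ (ofCoords φ v : Jet E Q r) i =
      iteratedDeriv i (fun t => ψ (φ.symm (polyCurve v t))) 0 := by
  have hv1 : v 0 ∈ φ.target ∧ φ.symm (v 0) ∈ ψ.source := by simpa using hv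
  obtain ⟨γ, h0, h⟩ := exists_smoothCurve hφ hv1.1
  have e1 : ofCoords φ v = mk r γ := by
    refine eq_of_coords_eq hφ (ofCoords_spec hφ hv1.1).1 h0 ?_
    rw [(ofCoords_spec hφ hv1.1).2]
    refine funext fun i => ?_
    rw [coords_mk hφ h0, h.iteratedDeriv_eq, iteratedDeriv_polyCurve]
  have e2 : γ 0 = φ.symm (v 0) := by
    have := h.self_of_nhds
    rw [polyCurve_zero] at this
    rw [← this]
    exact (φ.left_inv h0).symm
  rw [e1, coords_mk hψ (by rw [e2]; exact hv1.2)]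
  refine Filter.EventuallyEq.iteratedDeriv_eq _ ?_
  filter_upwards [h, γ.contMDiff.continuous.continuousAt.preimage_mem_nhds
      (φ.open_source.mem_nhds h0)] with t ht ht'
  have ht'' : γ t ∈ φ.source := ht'
  simp only [Function.comp_apply] at ht ⊢
  rw [← ht, φ.left_inv ht'']

theorem contDiffOn_coords_ofCoords {φ ψ : OpenPartialHomeomorph Q E}
    (hφ : φ ∈ IsManifold.maximalAtlas 𝓘(ℝ, E) ∞ Q)
    (hψ : ψ ∈ IsManifold.maximalAtlas 𝓘(ℝ, E) ∞ Q) :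
    ContDiffOn ℝ ∞ (fun v : Fin (r + 1) → E => coords ψ (ofCoords φ v : Jet E Q r))
      {v | v 0 ∈ (φ.symm ≫ₕ ψ).source} := by
  have hO : IsOpen {p : (Fin (r + 1) → E) × ℝ | polyCurve p.1 p.2 ∈ (φ.symm ≫ₕ ψ).source} :=
    (φ.symm ≫ₕ ψ).open_source.preimage (contDiff_polyCurve r).continuous
  have h0 : ContDiffOn ℝ ∞ (fun p : (Fin (r + 1) → E) × ℝ => ψ (φ.symm (polyCurve p.1 p.2)))
      {p | polyCurve p.1 p.2 ∈ (φ.symm ≫ₕ ψ).source} :=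
    (contDiffOn_transition hφ hψ).comp (contDiff_polyCurve r).contDiffOn (fun _ h => h)
  refine contDiffOn_pi.2 fun i => ?_
  have h1 := contDiffOn_iteratedDeriv_param
    (F := fun (v : Fin (r + 1) → E) t => ψ (φ.symm (polyCurve v t))) hO h0 i
  have h2 : ContDiffOn ℝ ∞ (fun v : Fin (r + 1) → E => (v, (0 : ℝ)))
      {v | v 0 ∈ (φ.symm ≫ₕ ψ).source} := (contDiff_id.prodMk contDiff_const).contDiffOn
  refine (h1.comp h2 ?_).congr fun v hv => coords_ofCoords_eq hφ hψ hv i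
  intro v hv
  change polyCurve v 0 ∈ (φ.symm ≫ₕ ψ).source
  rw [polyCurve_zero]
  exact hv

theorem contDiffOn_natChart_trans {φ ψ : OpenPartialHomeomorph Q E}
    (hφ : φ ∈ IsManifold.maximalAtlas 𝓘(ℝ, E) ∞ Q)
    (hψ : ψ ∈ IsManifold.maximalAtlas 𝓘(ℝ, E) ∞ Q) :
    ContDiffOn ℝ ∞ ((natChart r φ hφ).symm.trans (natChart r ψ hψ))
      ((natChart r φ hφ).symm.trans (natChart r ψ hψ)).source := by
  rw [natChart_trans_source]
  exact contDiffOn_coords_ofCoords hφ hψ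

variable (E Q r) in
/-- The natural charts of `T^{(r)}Q` induced by the charts of `Q`. -/
def chartedSpaceCore : ChartedSpaceCore (Fin (r + 1) → E) (Jet E Q r) where
  atlas := {e | ∃ φ, ∃ h : φ ∈ atlas E Q, e = natChart r φ (IsManifold.subset_maximalAtlas h)}
  chartAt x := natChart r (chartAt E x.base) (IsManifold.chart_mem_maximalAtlas _)
  mem_chart_source x := mem_chart_source E x.base
  chart_mem_atlas x := ⟨chartAt E x.base, chart_mem_atlas E _, rfl⟩
  open_source := by
    rintro _ _ ⟨φ, hφ, rfl⟩ ⟨ψ, hψ, rfl⟩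
    rw [natChart_trans_source]
    exact (φ.symm ≫ₕ ψ).open_source.preimage (continuous_apply 0)
  continuousOn_toFun := by
    rintro _ _ ⟨φ, hφ, rfl⟩ ⟨ψ, hψ, rfl⟩
    exact (contDiffOn_natChart_trans _ _).continuousOn

instance : TopologicalSpace (Jet E Q r) := (chartedSpaceCore E Q r).toTopologicalSpace

instance : ChartedSpace (Fin (r + 1) → E) (Jet E Q r) := (chartedSpaceCore E Q r).toChartedSpace

instance : IsManifold 𝓘(ℝ, Fin (r + 1) → E) ∞ (Jet E Q r) := by
  refine isManifold_of_contDiffOn _ _ _ ?_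
  intro e e' he he'
  obtain ⟨_, ⟨_, rfl⟩, _, ⟨⟨φ, hφ, rfl⟩, rfl⟩, he⟩ := he
  obtain ⟨_, ⟨_, rfl⟩, _, ⟨⟨ψ, hψ, rfl⟩, rfl⟩, he'⟩ := he'
  rw [mem_singleton_iff] at he he'
  subst he he'
  have := contDiffOn_natChart_trans (r := r) (IsManifold.subset_maximalAtlas hφ)
    (IsManifold.subset_maximalAtlas hψ)
  refine this.congr_mono (fun _ _ => rfl) ?_
  intro x hx
  exact hx.1

theorem coe_chartAt (x : Jet E Q r) :
    ⇑(chartAt (Fin (r + 1) → E) x) = coords (chartAt E x.base) := rfl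

theorem chartAt_source (x : Jet E Q r) :
    (chartAt (Fin (r + 1) → E) x).source = {y | y.base ∈ (chartAt E x.base).source} := rfl

/-- The canonical projection `τ_Q^{(r,k)} : T^{(k)}Q → T^{(r)}Q`, `[γ]^{(k)} ↦ [γ]^{(r)}`. -/
def proj {r k : ℕ} (h : r ≤ k) (x : Jet E Q k) : Jet E Q r :=
  Quotient.lift (s := contactSetoid E Q k) (fun γ => mk r γ)
    (fun _ _ ⟨h0, φ, hφ, hs, hj⟩ => mk_eq_mk.2 ⟨h0, φ, hφ, hs, fun j hjr => hj j (hjr.trans h)⟩) x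

/-- The lift `γ^{(r)} : ℝ → T^{(r)}Q` of a curve, `γ^{(r)}(t) = [γ_t]^{(r)}`. -/
def lift (r : ℕ) (γ : SmoothCurve E Q) (t : ℝ) : Jet E Q r := mk r (γ.shift t)

theorem lift_zero (γ : SmoothCurve E Q) : lift r γ 0 = mk r γ := by
  rw [lift, SmoothCurve.shift_zero]

theorem coords_lift {φ : OpenPartialHomeomorph Q E}
    (hφ : φ ∈ IsManifold.maximalAtlas 𝓘(ℝ, E) ∞ Q) (γ : SmoothCurve E Q) {t : ℝ}
    (h : γ t ∈ φ.source) (i : Fin (r + 1)) :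
    coords φ (lift r γ t) i = iteratedDeriv i (φ ∘ γ) t := by
  rw [lift, coords_mk hφ (by simpa [SmoothCurve.shift] using h)]
  have := congrFun (iteratedDeriv_comp_const_add (i : ℕ) (φ ∘ γ) t) 0
  rw [add_zero] at this
  exact this

/-- The velocity at `t = 0` of the lift of a curve, expressed in the preferred chart. -/
theorem hasMFDerivAt_lift (γ : SmoothCurve E Q) :
    HasMFDerivAt 𝓘(ℝ, ℝ) 𝓘(ℝ, Fin (r + 1) → E) (lift r γ) 0
      (ContinuousLinearMap.toSpanSingleton ℝ (fun i : Fin (r + 1) =>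
        iteratedDeriv (i + 1) (chartAt E (γ 0) ∘ γ) 0) : ℝ →L[ℝ] (Fin (r + 1) → E)) := by
  have hx : (lift r γ 0).base = γ 0 := by rw [lift_zero, base_mk]
  have hφ : chartAt E (γ 0) ∈ IsManifold.maximalAtlas 𝓘(ℝ, E) ∞ Q :=
    IsManifold.chart_mem_maximalAtlas _
  have hs : γ 0 ∈ (chartAt E (γ 0)).source := mem_chart_source E _
  have hev : ∀ᶠ t in 𝓝 (0 : ℝ), γ t ∈ (chartAt E (γ 0)).source :=
    γ.contMDiff.continuous.continuousAt.preimage_mem_nhds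
      ((chartAt E (γ 0)).open_source.mem_nhds hs)
  have hcoe : ⇑(chartAt (Fin (r + 1) → E) (lift r γ 0)) = coords (chartAt E (γ 0)) := by
    rw [coe_chartAt, hx]
  have hsrc : ∀ᶠ t in 𝓝 (0 : ℝ), lift r γ t ∈ (chartAt (Fin (r + 1) → E) (lift r γ 0)).source := by
    filter_upwards [hev] with t ht
    rw [chartAt_source, hx]
    change γ (t + 0) ∈ (chartAt E (γ 0)).source
    rwa [add_zero]
  have hc : HasDerivAt (fun t => coords (chartAt E (γ 0)) (lift r γ t))
      (fun i : Fin (r + 1) => iteratedDeriv (i + 1) (chartAt E (γ 0) ∘ γ) 0) 0 := by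
    rw [hasDerivAt_pi]
    intro i
    have h0 : ContDiffAt ℝ 1 (iteratedFDeriv ℝ i (chartAt E (γ 0) ∘ γ)) 0 :=
      (contDiffAt_chart_comp hφ γ hs).iteratedFDeriv_right (by exact_mod_cast le_top)
    have h1 : DifferentiableAt ℝ (iteratedDeriv i (chartAt E (γ 0) ∘ γ)) 0 := by
      rw [iteratedDeriv_eq_equiv_comp]
      exact (LinearIsometryEquiv.differentiableAt _).comp _ (h0.differentiableAt one_ne_zero)
    have h2 := h1.hasDerivAt
    rw [← iteratedDeriv_succ] at h2
    refine h2.congr_of_eventuallyEq ?_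
    filter_upwards [hev] with t ht using coords_lift hφ γ ht i
  have hcont : ContinuousAt (lift r γ) 0 := by
    have h1 : ContinuousAt ((chartAt (Fin (r + 1) → E) (lift r γ 0)).symm ∘
        fun t => chartAt (Fin (r + 1) → E) (lift r γ 0) (lift r γ t)) 0 := by
      refine ContinuousAt.comp ?_ ?_
      · exact (chartAt (Fin (r + 1) → E) (lift r γ 0)).continuousAt_symm
          (mem_chart_target _ _)
      · rw [hcoe]; exact hc.continuousAt
    refine h1.congr ?_
    filter_upwards [hsrc] with t ht using
      (chartAt (Fin (r + 1) → E) (lift r γ 0)).left_inv ht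
  refine ⟨hcont, ?_⟩
  have h3 : writtenInExtChartAt 𝓘(ℝ, ℝ) 𝓘(ℝ, Fin (r + 1) → E) 0 (lift r γ) =
      fun t => coords (chartAt E (γ 0)) (lift r γ t) := by
    ext1 t
    simp only [writtenInExtChartAt, extChartAt_model_space_eq_id, Function.comp_apply,
      PartialEquiv.refl_symm, PartialEquiv.refl_coe, id]
    exact congrFun hcoe _
  rw [h3]
  exact hc.hasFDerivAt.hasFDerivWithinAt

theorem mfderiv_lift (γ : SmoothCurve E Q) :
    mfderiv 𝓘(ℝ, ℝ) 𝓘(ℝ, Fin (r + 1) → E) (lift r γ) 0 (1 : ℝ) =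
      (fun i : Fin (r + 1) => iteratedDeriv (i + 1) (chartAt E (γ 0) ∘ γ) 0 :
        Fin (r + 1) → E) :=
  (congrArg (fun A : ℝ →L[ℝ] (Fin (r + 1) → E) => A 1) (hasMFDerivAt_lift γ).mfderiv).trans
    (by ext i; simp)

variable (E Q) in
/-- The canonical immersion `j_{r+1} : T^{(r+1)}Q → T(T^{(r)}Q)`: it sends `[γ]` to the velocity
at `t = 0` of the lift of `γ` to `T^{(r)}Q`. -/
def immersion (r : ℕ) (x : Jet E Q (r + 1)) :
    TangentBundle 𝓘(ℝ, Fin (r + 1) → E) (Jet E Q r) :=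
  Quotient.lift (s := contactSetoid E Q (r + 1))
    (fun γ => (⟨lift r γ 0, mfderiv 𝓘(ℝ, ℝ) 𝓘(ℝ, Fin (r + 1) → E) (lift r γ) 0 (1 : ℝ)⟩ :
      TangentBundle 𝓘(ℝ, Fin (r + 1) → E) (Jet E Q r))) (by
    intro γ₁ γ₂ h
    replace h : HasContact (r + 1) γ₁ γ₂ := h
    have e1 : lift r γ₁ 0 = lift r γ₂ 0 := by
      rw [lift_zero, lift_zero, mk_eq_mk]
      obtain ⟨h0, φ, hφ, hs, hj⟩ := h
      exact ⟨h0, φ, hφ, hs, fun j hjr => hj j (hjr.trans r.le_succ)⟩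
    have e2 : (fun i : Fin (r + 1) => iteratedDeriv (i + 1) (chartAt E (γ₁ 0) ∘ γ₁) 0) =
        fun i : Fin (r + 1) => iteratedDeriv (i + 1) (chartAt E (γ₂ 0) ∘ γ₂) 0 := by
      ext1 i
      rw [← h.eq_zero]
      exact h.chart (IsManifold.chart_mem_maximalAtlas _) (mem_chart_source E _) _
        (Nat.succ_le_of_lt i.2)
    have key : ∀ (y₁ y₂ : Jet E Q r) (v₁ v₂ : Fin (r + 1) → E), y₁ = y₂ → v₁ = v₂ →
        (⟨y₁, v₁⟩ : TangentBundle 𝓘(ℝ, Fin (r + 1) → E) (Jet E Q r)) = ⟨y₂, v₂⟩ := by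
      rintro y _ v _ rfl rfl
      rfl
    exact key _ _ _ _ e1 ((mfderiv_lift γ₁).trans (e2.trans (mfderiv_lift γ₂).symm))) x

/-- In the preferred chart, `j_{r+1} (q_(0), …, q_(r+1)) = (q_(0), …, q_(r); q_(1), …, q_(r+1))`. -/
theorem immersion_mk (r : ℕ) (γ : SmoothCurve E Q) :
    immersion E Q r (mk (r + 1) γ) =
      ⟨lift r γ 0, fun i : Fin (r + 1) => iteratedDeriv (i + 1) (chartAt E (γ 0) ∘ γ) 0⟩ := by
  change (⟨lift r γ 0, mfderiv 𝓘(ℝ, ℝ) 𝓘(ℝ, Fin (r + 1) → E) (lift r γ) 0 (1 : ℝ)⟩ :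
      TangentBundle 𝓘(ℝ, Fin (r + 1) → E) (Jet E Q r)) = _
  rw [mfderiv_lift]

end Jet
end Jets

section FiberDerivative

/-- The cotangent bundle `T*M` of a manifold `M` modelled on `V`. -/
abbrev Cotangent (V : Type*) [NormedAddCommGroup V] [NormedSpace ℝ V]
    (M : Type*) [TopologicalSpace M] [ChartedSpace V M] [IsManifold 𝓘(ℝ, V) ∞ M] : Type _ :=
  TotalSpace (V →L[ℝ] ℝ) (fun x : M => TangentSpace 𝓘(ℝ, V) x →L[ℝ] Trivial M ℝ x)

variable {V : Type*} [NormedAddCommGroup V] [NormedSpace ℝ V] [FiniteDimensional ℝ V]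

theorem finrank_strongDual (W : Type*) [NormedAddCommGroup W] [NormedSpace ℝ W]
    [FiniteDimensional ℝ W] : Module.finrank ℝ (StrongDual ℝ W) = Module.finrank ℝ W :=
  (LinearMap.toContinuousLinearMap (𝕜 := ℝ) (E := W) (F' := ℝ)).symm.finrank_eq.trans
    Subspace.dual_finrank_eq

variable (V) in
theorem bijective_inclusionInDoubleDual :
    Function.Bijective (NormedSpace.inclusionInDoubleDual ℝ V).toLinearMap := by
  have hinj : Function.Injective (NormedSpace.inclusionInDoubleDual ℝ V).toLinearMap :=
    (NormedSpace.inclusionInDoubleDualLi ℝ (E := V)).injective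
  let : AddCommGroup (StrongDual ℝ (StrongDual ℝ V)) := NormedAddCommGroup.toAddCommGroup
  exact ⟨hinj, (LinearMap.injective_iff_surjective_of_finrank_eq_finrank
    ((finrank_strongDual V).symm.trans (finrank_strongDual (StrongDual ℝ V)).symm)).1 hinj⟩

variable (V) in
/-- The canonical isomorphism `V ≃ V**`, `v ↦ (β ↦ β v)`, for finite-dimensional `V`. -/
def bidualEquiv : V ≃ₗ[ℝ] StrongDual ℝ (StrongDual ℝ V) :=
  LinearEquiv.ofBijective (NormedSpace.inclusionInDoubleDual ℝ V).toLinearMap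
    (bijective_inclusionInDoubleDual V)

theorem bidualEquiv_apply (v : V) (β : StrongDual ℝ V) : bidualEquiv V v β = β v := rfl

variable {M : Type*} [TopologicalSpace M] [ChartedSpace V M] [IsManifold 𝓘(ℝ, V) ∞ M]

/-- The fiber derivative `𝓕H : T*M → TM` of `H : T*M → ℝ`: at `α ∈ T*_x M` it is the element of
`T_x M ≃ (T*_x M)*` given by the derivative at `α` of the restriction of `H` to `T*_x M`. -/
def fiberDerivative (H : Cotangent V M → ℝ) (α : Cotangent V M) : TangentBundle 𝓘(ℝ, V) M :=
  ⟨α.proj, (bidualEquiv V).symm (fderiv ℝ (fun β : StrongDual ℝ V => H ⟨α.proj, β⟩) α.snd)⟩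

end FiberDerivative

section Mechanics

variable {E : Type*} [NormedAddCommGroup E] [NormedSpace ℝ E]
  {Q : Type*} [TopologicalSpace Q] [ChartedSpace E Q] [IsManifold 𝓘(ℝ, E) ∞ Q]

open Jet

/-- The partial derivative `∂f/∂q_(i)` of `f : T^{(r)}Q → ℝ` in the natural coordinates induced by
the chart `φ`, as the linear form `v ↦ ∑ₐ vᵃ ∂f/∂qᵃ_(i)` on `E`. -/
def partialDeriv {r : ℕ} (φ : OpenPartialHomeomorph Q E) (i : Fin (r + 1)) (f : Jet E Q r → ℝ)
    (x : Jet E Q r) : E →L[ℝ] ℝ :=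
  (fderiv ℝ (f ∘ ofCoords φ) (coords φ x)).comp
    (ContinuousLinearMap.single ℝ (fun _ : Fin (r + 1) => E) i)

/-- Tulczyjew's derivation on functions, `d_T f (x) = ⟨df, j_{r+1}(x)⟩` for `f` on `T^{(r)}Q` and
`x ∈ T^{(r+1)}Q` (for functions with values in a normed space). -/
def dT {F : Type*} [NormedAddCommGroup F] [NormedSpace ℝ F] {r : ℕ} (f : Jet E Q r → F)
    (x : Jet E Q (r + 1)) : F :=
  mfderiv 𝓘(ℝ, Fin (r + 1) → E) 𝓘(ℝ, F) f (immersion E Q r x).proj (immersion E Q r x).snd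

/-- The iterates `d_T^j`. -/
def dTIter {F : Type*} [NormedAddCommGroup F] [NormedSpace ℝ F] {r : ℕ} (f : Jet E Q r → F) :
    (j : ℕ) → Jet E Q (r + j) → F
  | 0 => f
  | j + 1 => dT (dTIter f j)

variable {m : ℕ}

/-- The Jacobi-Ostrogradsky momenta of a Lagrangian of order `k = m + 1` in the natural coordinates
induced by `φ`, as functions on `T^{(2k-1)}Q`: for `0 ≤ s ≤ k - 1`,
`p̂^(s) = ∑_{j=0}^{k-1-s} (-1)^j d_T^j (∂L/∂q_(s+1+j))`. -/
def ostrogradskyMomentum (φ : OpenPartialHomeomorph Q E) (L : Jet E Q (m + 1) → ℝ)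
    (s : Fin (m + 1)) (w : Jet E Q (2 * m + 1)) : E →L[ℝ] ℝ :=
  ∑ j : Fin (m + 1 - s), (-1 : ℝ) ^ (j : ℕ) •
    dTIter (partialDeriv φ ⟨s + 1 + j, by omega⟩ L) j
      (proj (show m + 1 + j ≤ 2 * m + 1 by omega) w)

/-- The Legendre-Ostrogradsky map `leg_L : T^{(2k-1)}Q → T*T^{(k-1)}Q`, `k = m + 1`, over
`T^{(k-1)}Q`: `leg_L(w) = ∑ₛ p̂^(s)(w) dq_(s)`, i.e. the covector corresponding to the
Poincaré-Cartan form. The right hand side does not depend on the chart; it is computed in the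
preferred chart of `Q` at the base point. -/
def legendreOstrogradsky (L : Jet E Q (m + 1) → ℝ) (w : Jet E Q (2 * m + 1)) :
    Cotangent (Fin (m + 1) → E) (Jet E Q m) :=
  ⟨proj (show m ≤ 2 * m + 1 by omega) w,
    ∑ s : Fin (m + 1), (ostrogradskyMomentum (chartAt E w.base) L s w).comp
      (mfderiv 𝓘(ℝ, Fin (m + 1) → E) 𝓘(ℝ, E) (fun y : Jet E Q m => coords (chartAt E w.base) y s)
        (proj (show m ≤ 2 * m + 1 by omega) w))⟩

/-- The Lagrangian energy `E_L = ∑_{s=0}^{k-1} q_(s+1) p̂^(s) - L : T^{(2k-1)}Q → ℝ`, `k = m + 1`. -/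
def energy (L : Jet E Q (m + 1) → ℝ) (w : Jet E Q (2 * m + 1)) : ℝ :=
  ∑ s : Fin (m + 1), ostrogradskyMomentum (chartAt E w.base) L s w
      (coords (chartAt E w.base) w ⟨s + 1, by omega⟩) -
    L (proj (show m + 1 ≤ 2 * m + 1 by omega) w)

/-- `L` is hyperregular if its Legendre-Ostrogradsky map is a global diffeomorphism. -/
def IsHyperregular (L : Jet E Q (m + 1) → ℝ) : Prop :=
  ∃ Φ : Diffeomorph 𝓘(ℝ, Fin (2 * m + 1 + 1) → E)
      (𝓘(ℝ, Fin (m + 1) → E).prod 𝓘(ℝ, (Fin (m + 1) → E) →L[ℝ] ℝ))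
      (Jet E Q (2 * m + 1)) (Cotangent (Fin (m + 1) → E) (Jet E Q m)) ∞,
    ∀ w, Φ w = legendreOstrogradsky L w

/-- The Legendre-Ostrogradsky map of a hyperregular Lagrangian, as a diffeomorphism. -/
def IsHyperregular.leg {L : Jet E Q (m + 1) → ℝ} (hL : IsHyperregular L) :
    Diffeomorph 𝓘(ℝ, Fin (2 * m + 1 + 1) → E)
      (𝓘(ℝ, Fin (m + 1) → E).prod 𝓘(ℝ, (Fin (m + 1) → E) →L[ℝ] ℝ))
      (Jet E Q (2 * m + 1)) (Cotangent (Fin (m + 1) → E) (Jet E Q m)) ∞ :=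
  hL.choose

theorem IsHyperregular.leg_apply {L : Jet E Q (m + 1) → ℝ} (hL : IsHyperregular L)
    (w : Jet E Q (2 * m + 1)) : hL.leg w = legendreOstrogradsky L w :=
  hL.choose_spec w

/-- The momentum coordinate `p^(i)` of a covector on `T^{(r)}Q` in the natural coordinates induced
by `φ`: the linear form `v ↦ ∑ₐ vᵃ p^(i)_a` on `E`, where `p^(i)_a = α (∂/∂qᵃ_(i))` and the
coordinate vector fields are the preimages of the standard ones under the derivative of the
coordinate map. -/
def momentumCoord {r : ℕ} (φ : OpenPartialHomeomorph Q E) (i : Fin (r + 1))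
    (α : Cotangent (Fin (r + 1) → E) (Jet E Q r)) : E →L[ℝ] ℝ :=
  (α.snd.comp (mfderiv 𝓘(ℝ, Fin (r + 1) → E) 𝓘(ℝ, Fin (r + 1) → E)
      (coords φ : Jet E Q r → Fin (r + 1) → E) α.proj).inverse :
      (Fin (r + 1) → E) →L[ℝ] ℝ).comp
    (ContinuousLinearMap.single ℝ (fun _ : Fin (r + 1) => E) i)

/-- `H` has, in the natural coordinates of `T*T^{(k-1)}Q` (`k = m + 1`) induced by the chart `φ` of
`Q`, the expression `∑_{j=0}^{k-2} q_(j+1) p^(j) + q̃_(k) p^(k-1) - L(q_(0), …, q_(k-1), q̃_(k))`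
with `q̃_(k) = q_(k) ∘ leg_L⁻¹`. -/
def HasOstrogradskyForm {L : Jet E Q (m + 1) → ℝ} (hL : IsHyperregular L)
    (φ : OpenPartialHomeomorph Q E) (H : Cotangent (Fin (m + 1) → E) (Jet E Q m) → ℝ) : Prop :=
  ∀ α : Cotangent (Fin (m + 1) → E) (Jet E Q m), α.proj.base ∈ φ.source →
    let q : Fin (m + 1) → E := coords φ α.proj
    let q' : E := coords φ (hL.leg.symm α) ⟨m + 1, by omega⟩
    H α = ∑ j : Fin m, momentumCoord φ j.castSucc α (q j.succ)
      + momentumCoord φ (Fin.last m) α q' - L (ofCoords φ (Fin.snoc q q'))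

/-- `H` is a Hamiltonian function of order `k = m + 1`: its fiber derivative takes values in the
holonomic submanifold `j_k(T^{(k)}Q)` of `TT^{(k-1)}Q`. -/
def IsHigherOrderHamiltonian [FiniteDimensional ℝ E]
    (H : Cotangent (Fin (m + 1) → E) (Jet E Q m) → ℝ) : Prop :=
  range (fiberDerivative H) ⊆ range (immersion E Q m)

end Mechanics

end HigherOrder

/-! Write `k = m + 1`. Since `leg_L` is bijective, `H ∘ leg_L = E_L` has exactly one solution, and
it is smooth because `E_L` and `leg_L⁻¹` are. The local expression determines `H` pointwise, because
charts cover `Q`. The work lies in the local expression in an arbitrary chart and in holonomy.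

`legendreOstrogradsky` and `energy` are computed in the preferred chart at each base point, so the
local expression requires the covector `∑ p̂^(s) dq_(s)` to be independent of the chart. Along a
curve `γ` the momenta are alternating sums of time derivatives of the `∂L/∂q_(i)`, and integration
by parts (`hasDerivAt_momentumForm_lift`) shows that the time derivative of the covector paired with
the jet of a variation `η` is `dL` applied to the jet of `η` wherever `η` vanishes: the
Euler-Lagrange term is multiplied by `η` and drops out. The expression in `dL` is intrinsic. So the
difference between the covectors of two charts, read along `γ`, is a linear differential operator in
`η` whose value has derivative zero at every zero of `η`. Such an operator is zero
(`eq_zero_of_hasDerivAt_curveJet`), which gives `momentumForm_eq_comp`. The energy is this covector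
paired with the velocity vector `(q_(1), …, q_(k))`, minus `L`, so it is also independent of the
chart.

For holonomy, on one cotangent fiber `H(δ) = δ(v + ι u(δ)) - L(q, u(δ))`, where `u = q̃_(k)` and `ι`
inserts the last slot. Since `p^(k-1) = ∂L/∂q_(k)`, the derivative of `u` cancels
(`hasFDerivAt_legendre`). The fiber derivative at `leg_L(w)` is then `(q_(1), …, q_(k))` at `w`,
which is `j_k` of the `k`-jet of `w`. -/

namespace HigherOrder

/-! ### Jets of curves in a vector space -/

section CurveJets

variable {E : Type*} [NormedAddCommGroup E] [NormedSpace ℝ E]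

theorem contDiffAt_iteratedDeriv {c : ℝ → E} {t : ℝ} (hc : ContDiffAt ℝ ∞ c t) (i : ℕ) :
    ContDiffAt ℝ ∞ (iteratedDeriv i c) t := by
  have h0 : ContDiffAt ℝ ∞ (iteratedFDeriv ℝ i c) t :=
    hc.iteratedFDeriv_right (by exact_mod_cast le_top)
  rw [iteratedDeriv_eq_equiv_comp]
  exact (LinearIsometryEquiv.contDiff _).contDiffAt.comp _ h0

theorem hasDerivAt_iteratedDeriv {c : ℝ → E} {t : ℝ} (hc : ContDiffAt ℝ ∞ c t) (i : ℕ) :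
    HasDerivAt (iteratedDeriv i c) (iteratedDeriv (i + 1) c t) t := by
  rw [iteratedDeriv_succ]
  exact ((contDiffAt_iteratedDeriv hc i).differentiableAt (by simp)).hasDerivAt

/-- The `r`-jet at `t` of a curve in a vector space. -/
def curveJet (r : ℕ) (c : ℝ → E) (t : ℝ) : Fin (r + 1) → E :=
  fun i => iteratedDeriv i c t

theorem curveJet_zero (r : ℕ) (c : ℝ → E) (t : ℝ) : curveJet r c t 0 = c t := by
  simp [curveJet]

theorem contDiffAt_curveJet (r : ℕ) {c : ℝ → E} {t : ℝ} (hc : ContDiffAt ℝ ∞ c t) :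
    ContDiffAt ℝ ∞ (curveJet r c) t :=
  contDiffAt_pi.2 fun i => contDiffAt_iteratedDeriv hc i

theorem hasDerivAt_curveJet (r : ℕ) {c : ℝ → E} {t : ℝ} (hc : ContDiffAt ℝ ∞ c t) :
    HasDerivAt (curveJet r c) (curveJet r (deriv c) t) t := by
  refine hasDerivAt_pi.2 fun i => ?_
  have := hasDerivAt_iteratedDeriv hc i
  rwa [iteratedDeriv_succ'] at this

theorem curveJet_add_smul (r : ℕ) {c η : ℝ → E} {t : ℝ} (hc : ContDiffAt ℝ ∞ c t)
    (hη : ContDiffAt ℝ ∞ η t) (ε : ℝ) :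
    curveJet r (fun τ => c τ + ε • η τ) t = curveJet r c t + ε • curveJet r η t := by
  funext i
  have h : ((i : ℕ) : WithTop ℕ∞) ≤ ∞ := by exact_mod_cast le_top
  have h1 : iteratedDeriv i (fun τ => ε • η τ) t = ε • iteratedDeriv i η t :=
    iteratedDeriv_fun_const_smul_field _ _
  simp only [curveJet, Pi.add_apply, Pi.smul_apply]
  rw [← h1]
  exact iteratedDeriv_fun_add (hc.of_le h) ((contDiffAt_const.smul hη).of_le h)

/-- Derivatives with respect to a parameter commute with iterated derivatives. -/
theorem deriv_iteratedDeriv_comm {Φ : ℝ → ℝ → E} {O : Set (ℝ × ℝ)} (hO : IsOpen O)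
    (hΦ : ContDiffOn ℝ ∞ (fun p : ℝ × ℝ => Φ p.1 p.2) O) (i : ℕ) :
    ∀ p ∈ O, deriv (fun ε => iteratedDeriv i (Φ ε) p.2) p.1 =
      iteratedDeriv i (fun τ => deriv (fun ε => Φ ε τ) p.1) p.2 := by
  induction i with
  | zero => intro p _; simp
  | succ i ih =>
    intro p hp
    set Ψ : ℝ × ℝ → E := fun p => iteratedDeriv i (Φ p.1) p.2 with hΨ
    have hΨO : ContDiffOn ℝ ∞ Ψ O := contDiffOn_iteratedDeriv_param hO hΦ i
    have hcd : ∀ q ∈ O, ContDiffAt ℝ ∞ Ψ q := fun q hq => hΨO.contDiffAt (hO.mem_nhds hq)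
    have hd : ∀ q ∈ O, DifferentiableAt ℝ Ψ q := fun q hq => (hcd q hq).differentiableAt (by simp)
    have hleft : ∀ q : ℝ × ℝ, HasDerivAt (fun ε : ℝ => (ε, q.2)) ((1 : ℝ), (0 : ℝ)) q.1 :=
      fun q => (hasDerivAt_id _).prodMk (hasDerivAt_const _ _)
    have hright : ∀ q : ℝ × ℝ, HasDerivAt (fun t : ℝ => (q.1, t)) ((0 : ℝ), (1 : ℝ)) q.2 :=
      fun q => (hasDerivAt_const _ _).prodMk (hasDerivAt_id _)
    have e1 : ∀ q ∈ O, deriv (fun ε => Ψ (ε, q.2)) q.1 = fderiv ℝ Ψ q (1, 0) := fun q hq =>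
      (HasFDerivAt.comp_hasDerivAt (x := q.1) (f := fun t : ℝ => (t, q.2)) (l := Ψ)
        (hd q hq).hasFDerivAt (hleft q)).deriv
    have e2 : ∀ q ∈ O, deriv (fun t => Ψ (q.1, t)) q.2 = fderiv ℝ Ψ q (0, 1) := fun q hq =>
      (HasFDerivAt.comp_hasDerivAt (x := q.2) (f := fun t : ℝ => (q.1, t)) (l := Ψ)
        (hd q hq).hasFDerivAt (hright q)).deriv
    have hdd : DifferentiableAt ℝ (fderiv ℝ Ψ) p :=
      ((hcd p hp).fderiv_right (m := ∞) (by simp)).differentiableAt (by simp)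
    have htwo : ∀ n : ℕ, (n : WithTop ℕ∞) ≤ ∞ := fun n => by exact_mod_cast le_top
    -- The induction step is the equality of mixed partial derivatives for `Ψ`, the `i`-th
    -- derivative in the second variable. Both sides become second derivatives of `Ψ` in the
    -- directions `(1, 0)` and `(0, 1)`.
    have hsymm : IsSymmSndFDerivAt ℝ Ψ p :=
      (hcd p hp).isSymmSndFDerivAt (by simpa using htwo 2)
    have hevl : ∀ᶠ ε in 𝓝 p.1, (ε, p.2) ∈ O :=
      (Continuous.prodMk_left p.2).continuousAt.preimage_mem_nhds (hO.mem_nhds hp)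
    have hevr : ∀ᶠ t in 𝓝 p.2, (p.1, t) ∈ O :=
      (Continuous.prodMk_right p.1).continuousAt.preimage_mem_nhds (hO.mem_nhds hp)
    have l1 : (fun ε => iteratedDeriv (i + 1) (Φ ε) p.2) =ᶠ[𝓝 p.1]
        fun ε => fderiv ℝ Ψ (ε, p.2) (0, 1) := by
      filter_upwards [hevl] with ε hε
      rw [iteratedDeriv_succ]
      exact e2 _ hε
    have r1 : (fun t => iteratedDeriv i (fun τ => deriv (fun ε => Φ ε τ) p.1) t) =ᶠ[𝓝 p.2]
        fun t => fderiv ℝ Ψ (p.1, t) (1, 0) := by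
      filter_upwards [hevr] with t ht
      rw [← ih _ ht]
      exact e1 _ ht
    rw [l1.deriv_eq, iteratedDeriv_succ, r1.deriv_eq]
    have l2 := (HasFDerivAt.comp_hasDerivAt (x := p.1) (f := fun t : ℝ => (t, p.2))
      (l := fderiv ℝ Ψ) hdd.hasFDerivAt (hleft p)).clm_apply
        (hasDerivAt_const p.1 ((0 : ℝ), (1 : ℝ)))
    have r2 := (HasFDerivAt.comp_hasDerivAt (x := p.2) (f := fun t : ℝ => (p.1, t))
      (l := fderiv ℝ Ψ) hdd.hasFDerivAt (hright p)).clm_apply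
        (hasDerivAt_const p.2 ((1 : ℝ), (0 : ℝ)))
    refine l2.deriv.trans (Eq.trans ?_ r2.deriv.symm)
    simpa using hsymm (1, 0) (0, 1)

end CurveJets

/-! ### Integration by parts and vanishing of differential operators -/

section IntegrationByParts

variable {E : Type*} [NormedAddCommGroup E] [NormedSpace ℝ E]

/-- The alternating sum `∑_{j < k - s} (-1)ʲ (A_{s+1+j})⁽ʲ⁾`. -/
def alternatingSum {F : Type*} [NormedAddCommGroup F] [NormedSpace ℝ F] (A : ℕ → ℝ → F)
    (k s : ℕ) (t : ℝ) : F :=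
  ∑ j ∈ Finset.range (k - s), (-1 : ℝ) ^ j • iteratedDeriv j (A (s + 1 + j)) t

section

variable {F : Type*} [NormedAddCommGroup F] [NormedSpace ℝ F] {A : ℕ → ℝ → F} {t : ℝ}

theorem alternatingSum_self (A : ℕ → ℝ → F) (k : ℕ) : alternatingSum A k k = 0 := by
  funext t
  simp [alternatingSum]

theorem contDiffAt_alternatingSum (hA : ∀ i, ContDiffAt ℝ ∞ (A i) t) (k s : ℕ) :
    ContDiffAt ℝ ∞ (alternatingSum A k s) t :=
  ContDiffAt.sum fun j _ => contDiffAt_const.smul (contDiffAt_iteratedDeriv (hA _) j)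

theorem differentiableAt_alternatingSum (hA : ∀ i, ContDiffAt ℝ ∞ (A i) t) (k s : ℕ) :
    DifferentiableAt ℝ (alternatingSum A k s) t :=
  (contDiffAt_alternatingSum hA k s).differentiableAt (by simp)

/-- Splitting off `j = 0` and shifting the index gives Ostrogradsky's recursion `p̂^(s) =
∂L/∂q_(s+1) - d_T p̂^(s+1)`, here along a curve. -/
theorem alternatingSum_eq_sub_deriv (hA : ∀ i, ContDiffAt ℝ ∞ (A i) t) {k s : ℕ} (hs : s < k) :
    alternatingSum A k s t = A (s + 1) t - deriv (alternatingSum A k (s + 1)) t := by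
  have h : HasDerivAt (alternatingSum A k (s + 1)) (∑ j ∈ Finset.range (k - (s + 1)),
      (-1 : ℝ) ^ j • iteratedDeriv (j + 1) (A (s + 1 + 1 + j)) t) t :=
    HasDerivAt.fun_sum fun j _ => (hasDerivAt_iteratedDeriv (hA _) j).const_smul _
  rw [h.deriv, alternatingSum, show k - s = k - (s + 1) + 1 by omega, Finset.sum_range_succ']
  simp only [pow_succ, mul_neg, mul_one, neg_smul, Finset.sum_neg_distrib, pow_zero, one_smul,
    iteratedDeriv_zero, add_zero]
  rw [add_comm, sub_eq_add_neg]
  congr 2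
  refine Finset.sum_congr rfl fun j _ => ?_
  rw [show s + 1 + (j + 1) = s + 1 + 1 + j by omega]

end

/-- The recursion makes the product-rule terms telescope. The upper boundary term vanishes because
`alternatingSum A k k` is an empty sum; the lower one, and the summand `i = 0` on the right, vanish
because `η t = 0`. -/
theorem hasDerivAt_sum_alternatingSum {A : ℕ → ℝ → E →L[ℝ] ℝ} {η : ℝ → E} {t : ℝ}
    (hA : ∀ i, ContDiffAt ℝ ∞ (A i) t) (hη : ContDiffAt ℝ ∞ η t) (h0 : η t = 0) (k : ℕ) :
    HasDerivAt (fun τ => ∑ s ∈ Finset.range k, alternatingSum A k s τ (iteratedDeriv s η τ))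
      (∑ i ∈ Finset.range (k + 1), A i t (iteratedDeriv i η t)) t := by
  have h : HasDerivAt (fun τ => ∑ s ∈ Finset.range k, alternatingSum A k s τ (iteratedDeriv s η τ))
      (∑ s ∈ Finset.range k, (deriv (alternatingSum A k s) t (iteratedDeriv s η t) +
        alternatingSum A k s t (iteratedDeriv (s + 1) η t))) t :=
    HasDerivAt.fun_sum fun s _ =>
      (differentiableAt_alternatingSum hA k s).hasDerivAt.clm_apply (hasDerivAt_iteratedDeriv hη s)
  convert h using 1
  have h1 : ∀ s ∈ Finset.range k, deriv (alternatingSum A k s) t (iteratedDeriv s η t) +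
      alternatingSum A k s t (iteratedDeriv (s + 1) η t) =
      (deriv (alternatingSum A k s) t (iteratedDeriv s η t) -
        deriv (alternatingSum A k (s + 1)) t (iteratedDeriv (s + 1) η t)) +
      A (s + 1) t (iteratedDeriv (s + 1) η t) := by
    intro s hs
    rw [alternatingSum_eq_sub_deriv hA (Finset.mem_range.1 hs), sub_apply]
    ring
  rw [Finset.sum_congr rfl h1, Finset.sum_add_distrib, Finset.sum_range_succ',
    Finset.sum_range_sub' (fun s => deriv (alternatingSum A k s) t (iteratedDeriv s η t)),
    alternatingSum_self]
  have h2 : deriv (0 : ℝ → E →L[ℝ] ℝ) t = 0 := by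
    simp
  simp [h0, h2]

/-- There is a smooth curve whose `(r + 1)`-jet at `t` vanishes except in order `i + 1`. -/
theorem exists_curveJet_eq_single (r : ℕ) (i : Fin (r + 1)) (x : E) (t : ℝ) :
    ∃ η : ℝ → E, ContDiff ℝ ∞ η ∧
      curveJet (r + 1) η t = Pi.single (M := fun _ : Fin (r + 1 + 1) => E) i.succ x := by
  refine ⟨fun τ => polyCurve (Pi.single (M := fun _ : Fin (r + 1 + 1) => E) i.succ x) (τ - t),
    (contDiff_polyCurve_right _).comp (contDiff_id.sub contDiff_const), ?_⟩
  funext j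
  have h := congrFun (iteratedDeriv_comp_sub_const (j : ℕ)
    (polyCurve (Pi.single (M := fun _ : Fin (r + 1 + 1) => E) i.succ x)) t) t
  rw [sub_self, iteratedDeriv_polyCurve] at h
  exact h

/-- A differential operator of order `r` along a curve whose value on `η` is stationary wherever
`η` vanishes is zero. -/
theorem eq_zero_of_hasDerivAt_curveJet {r : ℕ} {b : ℝ → (Fin (r + 1) → E) →L[ℝ] ℝ} {I : Set ℝ}
    (hI : IsOpen I) (hb : ∀ t ∈ I, DifferentiableAt ℝ b t)
    (h : ∀ η : ℝ → E, ContDiff ℝ ∞ η → ∀ t ∈ I, η t = 0 →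
      HasDerivAt (fun τ => b τ (curveJet r η τ)) 0 t) :
    ∀ t ∈ I, b t = 0 := by
  -- Descending induction on the order `i`, from the top coefficient downwards, simultaneously for
  -- all `t ∈ I`, so that each coefficient already treated vanishes on an open set and so does its
  -- derivative.
  have key : ∀ n : ℕ, ∀ i : Fin (r + 1), r - i < n → ∀ t ∈ I, ∀ x : E,
      b t (Pi.single (M := fun _ : Fin (r + 1) => E) i x) = 0 := by
    intro n
    induction n with
    | zero => intro i hi; omega
    | succ n ih =>
      intro i hi t ht x
      -- With only the derivative of order `i + 1` nonzero at `t`, the jet of `η'` isolates the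
      -- coefficient of order `i`, while the jet of `η` sees only order `i + 1`, or nothing when `i
      -- = r`.
      obtain ⟨η, hη, hj⟩ := exists_curveJet_eq_single r i x t
      have hj' : ∀ j : ℕ, ∀ hjr : j < r + 1 + 1, iteratedDeriv j η t =
          if j = i + 1 then x else 0 := by
        intro j hjr
        have := congrFun hj ⟨j, hjr⟩
        rw [Pi.single_apply] at this
        simpa [curveJet, Fin.ext_iff] using this
      have h0 : η t = 0 := by simpa using hj' 0 (by omega)
      have h1 := (hb t ht).hasDerivAt.clm_apply (hasDerivAt_curveJet r hη.contDiffAt (t := t))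
      have h2 := h1.unique (h η hη t ht h0)
      have h3 : curveJet r (deriv η) t = Pi.single (M := fun _ : Fin (r + 1) => E) i x := by
        funext j
        rw [curveJet, ← iteratedDeriv_succ', hj' _ (by omega), Pi.single_apply]
        simp [Fin.ext_iff]
      have h4 : deriv b t (curveJet r η t) = 0 := by
        by_cases hir : (i : ℕ) + 1 < r + 1
        · have h5 : curveJet r η t =
              Pi.single (M := fun _ : Fin (r + 1) => E) ⟨i + 1, hir⟩ x := by
            funext j
            rw [curveJet, hj' _ (by omega), Pi.single_apply]
            simp [Fin.ext_iff]
          rw [h5]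
          have h6 := (hb t ht).hasDerivAt.clm_apply (hasDerivAt_const t
            (Pi.single (M := fun _ : Fin (r + 1) => E) ⟨i + 1, hir⟩ x))
          have h7 : (fun τ => b τ (Pi.single (M := fun _ : Fin (r + 1) => E) ⟨i + 1, hir⟩ x))
              =ᶠ[𝓝 t] fun _ => (0 : ℝ) := by
            filter_upwards [hI.mem_nhds ht] with τ hτ
            exact ih ⟨i + 1, hir⟩ (by simp only; omega) τ hτ x
          have h8 := h6.unique ((hasDerivAt_const t (0 : ℝ)).congr_of_eventuallyEq h7)
          simpa using h8
        · have h5 : curveJet r η t = 0 := by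
            funext j
            rw [curveJet, hj' _ (by omega), if_neg (by omega)]
            rfl
          rw [h5, map_zero]
      rw [h4, h3, zero_add] at h2
      exact h2
  intro t ht
  ext v
  rw [← Finset.univ_sum_single v, map_sum]
  exact Finset.sum_eq_zero fun i _ => key (r + 1) i (by omega) t ht (v i)

end IntegrationByParts

/-! ### Natural coordinates on the higher-order tangent bundle -/

section JetCharts

theorem isOpen_trans_source {E : Type*} [NormedAddCommGroup E] {Q : Type*}
    [TopologicalSpace Q] (φ ψ : OpenPartialHomeomorph Q E) (r : ℕ) :
    IsOpen {v : Fin (r + 1) → E | v 0 ∈ (φ.symm ≫ₕ ψ).source} :=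
  (φ.symm ≫ₕ ψ).open_source.preimage (continuous_apply 0)

variable {E : Type*} [NormedAddCommGroup E] [NormedSpace ℝ E]
  {Q : Type*} [TopologicalSpace Q] [ChartedSpace E Q] [IsManifold 𝓘(ℝ, E) ∞ Q]

namespace Jet

variable {r : ℕ} {φ ψ : OpenPartialHomeomorph Q E}

theorem base_ofCoords (hφ : φ ∈ IsManifold.maximalAtlas 𝓘(ℝ, E) ∞ Q) {v : Fin (r + 1) → E}
    (hv : v 0 ∈ φ.target) : (ofCoords φ v : Jet E Q r).base = φ.symm (v 0) := by
  obtain ⟨h1, h2⟩ := ofCoords_spec (r := r) hφ hv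
  rw [← h2, coords_zero, h2, φ.left_inv h1]

theorem coords_zero_mem_target {x : Jet E Q r} (hx : x.base ∈ φ.source) :
    coords φ x 0 ∈ φ.target := by
  rw [coords_zero]
  exact φ.map_source hx

theorem ofCoords_coords (hφ : φ ∈ IsManifold.maximalAtlas 𝓘(ℝ, E) ∞ Q) {x : Jet E Q r}
    (hx : x.base ∈ φ.source) : ofCoords φ (coords φ x) = x :=
  (natChart r φ hφ).left_inv hx

theorem coords_ofCoords (hφ : φ ∈ IsManifold.maximalAtlas 𝓘(ℝ, E) ∞ Q) {v : Fin (r + 1) → E}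
    (hv : v 0 ∈ φ.target) : coords φ (ofCoords φ v : Jet E Q r) = v :=
  (ofCoords_spec hφ hv).2

theorem coords_zero_mem_trans_source {x : Jet E Q r} (hx : x.base ∈ φ.source)
    (hx' : x.base ∈ ψ.source) : coords φ x 0 ∈ (φ.symm ≫ₕ ψ).source := by
  rw [coords_zero]
  simp [φ.map_source hx, φ.left_inv hx, hx']

theorem continuous_base : Continuous (base : Jet E Q r → Q) := by
  rw [continuous_iff_continuousAt]
  intro x
  have h1 : ContinuousAt (fun y : Jet E Q r => coords (chartAt E x.base) y 0) x :=
    (continuous_apply (0 : Fin (r + 1))).continuousAt.comp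
      ((chartAt (Fin (r + 1) → E) x).continuousAt (mem_chart_source _ x))
  have h2 : ContinuousAt (chartAt E x.base).symm (coords (chartAt E x.base) x 0) :=
    (chartAt E x.base).continuousAt_symm (coords_zero_mem_target (mem_chart_source E x.base))
  refine (ContinuousAt.comp (f := fun y : Jet E Q r => coords (chartAt E x.base) y 0)
    h2 h1).congr ?_
  filter_upwards [(chartAt (Fin (r + 1) → E) x).open_source.mem_nhds (mem_chart_source _ x)]
    with y hy
  rw [chartAt_source] at hy
  simp only [Function.comp_apply, coords_zero]
  exact (chartAt E x.base).left_inv hy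

theorem eventually_base_mem {U : Set Q} (hU : IsOpen U) {x : Jet E Q r} (hx : x.base ∈ U) :
    ∀ᶠ y in 𝓝 x, y.base ∈ U :=
  continuous_base.continuousAt.preimage_mem_nhds (hU.mem_nhds hx)

theorem contMDiffAt_coords_chartAt (x : Jet E Q r) :
    ContMDiffAt 𝓘(ℝ, Fin (r + 1) → E) 𝓘(ℝ, Fin (r + 1) → E) ∞
      (coords (chartAt E x.base) : Jet E Q r → Fin (r + 1) → E) x := by
  rw [← coe_chartAt]
  exact contMDiffAt_of_mem_maximalAtlas (IsManifold.chart_mem_maximalAtlas x)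
    (mem_chart_source _ x)

theorem contDiffAt_coords_ofCoords (hφ : φ ∈ IsManifold.maximalAtlas 𝓘(ℝ, E) ∞ Q)
    (hψ : ψ ∈ IsManifold.maximalAtlas 𝓘(ℝ, E) ∞ Q) {v : Fin (r + 1) → E}
    (hv : v 0 ∈ (φ.symm ≫ₕ ψ).source) :
    ContDiffAt ℝ ∞ (fun v : Fin (r + 1) → E => coords ψ (ofCoords φ v : Jet E Q r)) v :=
  (contDiffOn_coords_ofCoords hφ hψ).contDiffAt ((isOpen_trans_source φ ψ r).mem_nhds hv)

theorem coords_eventuallyEq (hφ : φ ∈ IsManifold.maximalAtlas 𝓘(ℝ, E) ∞ Q) {x : Jet E Q r}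
    (hx : x.base ∈ φ.source) :
    (coords ψ : Jet E Q r → Fin (r + 1) → E) =ᶠ[𝓝 x]
      (fun v : Fin (r + 1) → E => coords ψ (ofCoords φ v : Jet E Q r)) ∘ coords φ := by
  filter_upwards [eventually_base_mem φ.open_source hx] with y hy
  simp [ofCoords_coords hφ hy]

/-- The manifold structure on jets is built from the chosen atlas only, so a chart of the maximal
atlas is compared with the preferred chart through the smooth coordinate change. -/
theorem contMDiffAt_coords (hφ : φ ∈ IsManifold.maximalAtlas 𝓘(ℝ, E) ∞ Q) {x : Jet E Q r}
    (hx : x.base ∈ φ.source) :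
    ContMDiffAt 𝓘(ℝ, Fin (r + 1) → E) 𝓘(ℝ, Fin (r + 1) → E) ∞
      (coords φ : Jet E Q r → Fin (r + 1) → E) x := by
  have hc : chartAt E x.base ∈ IsManifold.maximalAtlas 𝓘(ℝ, E) ∞ Q :=
    IsManifold.chart_mem_maximalAtlas _
  have hs := mem_chart_source E x.base
  refine ContMDiffAt.congr_of_eventuallyEq ?_ (coords_eventuallyEq hc hs)
  exact (contDiffAt_coords_ofCoords hc hφ
    (coords_zero_mem_trans_source hs hx)).contMDiffAt.comp x (contMDiffAt_coords_chartAt x)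

theorem contMDiffAt_ofCoords (hφ : φ ∈ IsManifold.maximalAtlas 𝓘(ℝ, E) ∞ Q)
    {v : Fin (r + 1) → E} (hv : v 0 ∈ φ.target) :
    ContMDiffAt 𝓘(ℝ, Fin (r + 1) → E) 𝓘(ℝ, Fin (r + 1) → E) ∞
      (ofCoords φ : (Fin (r + 1) → E) → Jet E Q r) v := by
  set x : Jet E Q r := ofCoords φ v with hxdef
  have hxφ : x.base ∈ φ.source := (ofCoords_spec hφ hv).1
  have hc : chartAt E x.base ∈ IsManifold.maximalAtlas 𝓘(ℝ, E) ∞ Q :=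
    IsManifold.chart_mem_maximalAtlas _
  have hs := mem_chart_source E x.base
  have hv' : v 0 ∈ (φ.symm ≫ₕ chartAt E x.base).source := by
    rw [← coords_ofCoords hφ hv]
    exact coords_zero_mem_trans_source hxφ hs
  have h1 := contDiffAt_coords_ofCoords (r := r) hφ hc hv'
  have h2 : ContMDiffAt 𝓘(ℝ, Fin (r + 1) → E) 𝓘(ℝ, Fin (r + 1) → E) ∞
      (chartAt (Fin (r + 1) → E) x).symm (coords (chartAt E x.base) x) :=
    contMDiffAt_symm_of_mem_maximalAtlas (IsManifold.chart_mem_maximalAtlas x)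
      (mem_chart_target _ x)
  refine (ContMDiffAt.comp v (g := (chartAt (Fin (r + 1) → E) x).symm) h2
    h1.contMDiffAt).congr_of_eventuallyEq ?_
  filter_upwards [(isOpen_trans_source φ (chartAt E x.base) r).mem_nhds hv'] with u hu
  have hu' : u 0 ∈ φ.target ∧ φ.symm (u 0) ∈ (chartAt E x.base).source := by simpa using hu
  refine ((chartAt (Fin (r + 1) → E) x).left_inv ?_).symm
  rw [chartAt_source, mem_ofPred_eq, base_ofCoords hφ hu'.1]
  exact hu'.2

/-- The derivative of the natural coordinates induced by `φ`. -/
def coordsDeriv (φ : OpenPartialHomeomorph Q E) (x : Jet E Q r) :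
    (Fin (r + 1) → E) →L[ℝ] (Fin (r + 1) → E) :=
  mfderiv 𝓘(ℝ, Fin (r + 1) → E) 𝓘(ℝ, Fin (r + 1) → E)
    (coords φ : Jet E Q r → Fin (r + 1) → E) x

/-- `momentumCoord` uses `ContinuousLinearMap.inverse`, which is zero on non-invertible maps;
invertibility makes it the true inverse. -/
theorem exists_equiv_coordsDeriv (hφ : φ ∈ IsManifold.maximalAtlas 𝓘(ℝ, E) ∞ Q)
    {x : Jet E Q r} (hx : x.base ∈ φ.source) :
    ∃ A : (Fin (r + 1) → E) ≃L[ℝ] (Fin (r + 1) → E),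
      coordsDeriv φ x = (A : (Fin (r + 1) → E) →L[ℝ] (Fin (r + 1) → E)) := by
  have ht := coords_zero_mem_target hx
  have h1 := (contMDiffAt_coords hφ hx).mdifferentiableAt (by simp)
  have h2 := (contMDiffAt_ofCoords (r := r) hφ ht).mdifferentiableAt (by simp)
  have h2x := ofCoords_coords hφ hx
  have hopen : IsOpen {v : Fin (r + 1) → E | v 0 ∈ φ.target} :=
    φ.open_target.preimage (continuous_apply 0)
  have e1 : (mfderiv 𝓘(ℝ, Fin (r + 1) → E) 𝓘(ℝ, Fin (r + 1) → E)
        (coords φ : Jet E Q r → Fin (r + 1) → E) x).comp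
      (mfderiv 𝓘(ℝ, Fin (r + 1) → E) 𝓘(ℝ, Fin (r + 1) → E)
        (ofCoords φ : _ → Jet E Q r) (coords φ x)) = ContinuousLinearMap.id ℝ _ := by
    have := mfderiv_comp (coords φ x) (g := (coords φ : Jet E Q r → Fin (r + 1) → E))
      (f := (ofCoords φ : _ → Jet E Q r)) (by rw [h2x]; exact h1) h2
    rw [h2x] at this
    rw [← this]
    have hev : (coords φ : Jet E Q r → Fin (r + 1) → E) ∘ (ofCoords φ : _ → Jet E Q r)
        =ᶠ[𝓝 (coords φ x)] id := by
      filter_upwards [hopen.mem_nhds ht] with v hv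
      exact coords_ofCoords hφ hv
    rw [hev.mfderiv_eq, mfderiv_id]
  have e2 : (mfderiv 𝓘(ℝ, Fin (r + 1) → E) 𝓘(ℝ, Fin (r + 1) → E)
        (ofCoords φ : _ → Jet E Q r) (coords φ x)).comp
      (mfderiv 𝓘(ℝ, Fin (r + 1) → E) 𝓘(ℝ, Fin (r + 1) → E)
        (coords φ : Jet E Q r → Fin (r + 1) → E) x) = ContinuousLinearMap.id ℝ _ := by
    rw [← mfderiv_comp x h2 h1]
    have hev : (ofCoords φ : _ → Jet E Q r) ∘ (coords φ : Jet E Q r → Fin (r + 1) → E)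
        =ᶠ[𝓝 x] id := by
      filter_upwards [eventually_base_mem φ.open_source hx] with y hy
      exact ofCoords_coords hφ hy
    rw [hev.mfderiv_eq, mfderiv_id]
  exact ⟨ContinuousLinearEquiv.equivOfInverse _ _ (fun v => congrArg (fun f => f v) e2)
    (fun v => congrArg (fun f => f v) e1), rfl⟩

/-- Tangent vectors at `x` are by construction represented in the preferred chart at `x`, where the
coordinate map reads as the identity. -/
theorem coordsDeriv_chartAt (x : Jet E Q r) :
    coordsDeriv (chartAt E x.base) x =
      ContinuousLinearMap.id ℝ (Fin (r + 1) → E) := by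
  refine HasMFDerivAt.mfderiv ⟨(contMDiffAt_coords_chartAt x).continuousAt, ?_⟩
  refine ((hasFDerivAt_id _).congr_of_eventuallyEq ?_).hasFDerivWithinAt
  filter_upwards [(chartAt (Fin (r + 1) → E) x).open_target.mem_nhds (mem_chart_target _ x)]
    with v hv
  exact (chartAt (Fin (r + 1) → E) x).right_inv hv

theorem coordsDeriv_eq_comp (hφ : φ ∈ IsManifold.maximalAtlas 𝓘(ℝ, E) ∞ Q)
    (hψ : ψ ∈ IsManifold.maximalAtlas 𝓘(ℝ, E) ∞ Q) {x : Jet E Q r} (hx : x.base ∈ φ.source)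
    (hx' : x.base ∈ ψ.source) :
    coordsDeriv ψ x =
    (fderiv ℝ (fun v : Fin (r + 1) → E => coords ψ (ofCoords φ v : Jet E Q r)) (coords φ x)).comp
      (coordsDeriv φ x) := by
  have h := mfderiv_comp (I' := 𝓘(ℝ, Fin (r + 1) → E)) (I'' := 𝓘(ℝ, Fin (r + 1) → E)) x
    (g := fun v : Fin (r + 1) → E => coords ψ (ofCoords φ v : Jet E Q r))
    (f := (coords φ : Jet E Q r → Fin (r + 1) → E))
    ((contDiffAt_coords_ofCoords hφ hψ (coords_zero_mem_trans_source hx hx')).differentiableAt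
      (by simp)).mdifferentiableAt ((contMDiffAt_coords hφ hx).mdifferentiableAt (by simp))
  rw [mfderiv_eq_fderiv] at h
  exact ((coords_eventuallyEq hφ hx).mfderiv_eq).trans h

theorem mfderiv_coords_apply (hφ : φ ∈ IsManifold.maximalAtlas 𝓘(ℝ, E) ∞ Q)
    {x : Jet E Q r} (hx : x.base ∈ φ.source) (i : Fin (r + 1)) :
    mfderiv 𝓘(ℝ, Fin (r + 1) → E) 𝓘(ℝ, E) (fun y : Jet E Q r => coords φ y i) x =
      (ContinuousLinearMap.proj (R := ℝ) (φ := fun _ : Fin (r + 1) => E) i).comp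
        (coordsDeriv φ x) := by
  have h := mfderiv_comp (I' := 𝓘(ℝ, Fin (r + 1) → E)) (I'' := 𝓘(ℝ, E)) x
    (g := ContinuousLinearMap.proj (R := ℝ) (φ := fun _ : Fin (r + 1) => E) i)
    (f := (coords φ : Jet E Q r → Fin (r + 1) → E))
    (ContinuousLinearMap.differentiableAt _).mdifferentiableAt
    ((contMDiffAt_coords hφ hx).mdifferentiableAt (by simp))
  rw [mfderiv_eq_fderiv, ContinuousLinearMap.fderiv] at h
  exact h

/-- The coordinate change of `T^{(r)}Q` on jets of curves. -/
theorem coords_ofCoords_curveJet (hφ : φ ∈ IsManifold.maximalAtlas 𝓘(ℝ, E) ∞ Q)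
    (hψ : ψ ∈ IsManifold.maximalAtlas 𝓘(ℝ, E) ∞ Q) {c : ℝ → E} {t : ℝ}
    (hc : ContDiffAt ℝ ∞ c t) (ht : c t ∈ (φ.symm ≫ₕ ψ).source) :
    coords ψ (ofCoords φ (curveJet r c t) : Jet E Q r) = curveJet r (ψ ∘ φ.symm ∘ c) t := by
  funext i
  rw [coords_ofCoords_eq hφ hψ (by rwa [curveJet_zero])]
  have hadd : ContDiffAt ℝ ∞ (fun s : ℝ => t + s) 0 := contDiffAt_const.add contDiffAt_id
  have hc' : ContDiffAt ℝ ∞ (fun s => c (t + s)) 0 :=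
    ContDiffAt.comp (g := c) (0 : ℝ) (by simpa using hc) hadd
  have h1 : ∀ (f : ℝ → E) (j : ℕ), iteratedDeriv j (fun s => f (t + s)) 0 = iteratedDeriv j f t := by
    intro f j
    simpa using congrFun (iteratedDeriv_comp_const_add j f t) 0
  have hF : ContDiffAt ℝ ∞ (ψ ∘ φ.symm) (c t) :=
    (contDiffOn_transition hφ hψ).contDiffAt ((φ.symm ≫ₕ ψ).open_source.mem_nhds ht)
  -- The coordinate change is computed on the polynomial representative; only the `r`-jet matters,
  -- so the translated curve may replace it.
  have h2 := jet_comp_congr (f := ψ ∘ φ.symm) (c₁ := polyCurve (curveJet r c t))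
    (c₂ := fun s => c (t + s)) (r := r)
    (by rwa [polyCurve_zero, curveJet_zero]) (contDiff_polyCurve_right _).contDiffAt hc'
    (fun j hj => by
      rw [h1]
      exact iteratedDeriv_polyCurve (curveJet r c t) ⟨j, Nat.lt_succ_of_le hj⟩)
    i (Nat.le_of_lt_succ i.2)
  exact h2.trans (h1 (ψ ∘ φ.symm ∘ c) i)

/-- The tangent map of the coordinate change of `T^{(r)}Q` on jets of variations of curves. -/
theorem fderiv_coords_ofCoords_curveJet (hφ : φ ∈ IsManifold.maximalAtlas 𝓘(ℝ, E) ∞ Q)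
    (hψ : ψ ∈ IsManifold.maximalAtlas 𝓘(ℝ, E) ∞ Q) {c η : ℝ → E} {t : ℝ} {I : Set ℝ}
    (hI : IsOpen I) (htI : t ∈ I) (hc : ContDiffOn ℝ ∞ c I) (hη : ContDiff ℝ ∞ η)
    (ht : c t ∈ (φ.symm ≫ₕ ψ).source) :
    fderiv ℝ (fun v : Fin (r + 1) → E => coords ψ (ofCoords φ v : Jet E Q r)) (curveJet r c t)
      (curveJet r η t) = curveJet r (fun τ => fderiv ℝ (ψ ∘ φ.symm) (c τ) (η τ)) t := by
  have hct : ContDiffAt ℝ ∞ c t := hc.contDiffAt (hI.mem_nhds htI)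
  have hG : DifferentiableAt ℝ
      (fun v : Fin (r + 1) → E => coords ψ (ofCoords φ v : Jet E Q r)) (curveJet r c t) :=
    (contDiffAt_coords_ofCoords hφ hψ (by rwa [curveJet_zero])).differentiableAt (by simp)
  -- `O` is the open set of pairs `(ε, τ)` at which the varied curve `c + ε η` is defined and stays
  -- in the overlap of the charts. The claim follows by differentiating the jet of its image in `ε`
  -- at `0` and exchanging the derivatives in `ε` and `τ`.
  let O : Set (ℝ × ℝ) := (univ ×ˢ I) ∩
    (fun p : ℝ × ℝ => c p.2 + p.1 • η p.2) ⁻¹' (φ.symm ≫ₕ ψ).source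
  have hcη : ContDiffOn ℝ ∞ (fun p : ℝ × ℝ => c p.2 + p.1 • η p.2) (univ ×ˢ I) :=
    (hc.comp contDiff_snd.contDiffOn (fun p hp => hp.2)).add
      (contDiff_fst.smul (hη.comp contDiff_snd)).contDiffOn
  have hO : IsOpen O :=
    hcη.continuousOn.isOpen_inter_preimage (isOpen_univ.prod hI) (φ.symm ≫ₕ ψ).open_source
  have hΦ : ContDiffOn ℝ ∞ (fun p : ℝ × ℝ => (ψ ∘ φ.symm) (c p.2 + p.1 • η p.2)) O :=
    (contDiffOn_transition hφ hψ).comp (hcη.mono inter_subset_left) (fun p hp => hp.2)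
  have hcurve : ∀ τ : ℝ, HasDerivAt (fun ε : ℝ => c τ + ε • η τ) (η τ) 0 := fun τ => by
    simpa using ((hasDerivAt_id (0 : ℝ)).smul_const (η τ)).const_add (c τ)
  have hmem : ((0 : ℝ), t) ∈ O := ⟨⟨mem_univ _, htI⟩, by simpa using ht⟩
  have h1 : HasDerivAt (fun ε : ℝ =>
      coords ψ (ofCoords φ (curveJet r c t + ε • curveJet r η t) : Jet E Q r))
      (fderiv ℝ (fun v : Fin (r + 1) → E => coords ψ (ofCoords φ v : Jet E Q r)) (curveJet r c t)
      (curveJet r η t)) 0 := by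
    have hl : HasDerivAt (fun ε : ℝ => curveJet r c t + ε • curveJet r η t) (curveJet r η t) 0 := by
      simpa using ((hasDerivAt_id (0 : ℝ)).smul_const (curveJet r η t)).const_add (curveJet r c t)
    refine HasFDerivAt.comp_hasDerivAt (x := (0 : ℝ))
      (f := fun ε : ℝ => curveJet r c t + ε • curveJet r η t)
      (l := fun v : Fin (r + 1) → E => coords ψ (ofCoords φ v : Jet E Q r)) ?_ hl
    rw [zero_smul, add_zero]
    exact hG.hasFDerivAt
  have h2 : (fun ε : ℝ =>
      coords ψ (ofCoords φ (curveJet r c t + ε • curveJet r η t) : Jet E Q r)) =ᶠ[𝓝 0]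
      fun ε => curveJet r (fun τ => (ψ ∘ φ.symm) (c τ + ε • η τ)) t := by
    have hev : ∀ᶠ ε in 𝓝 (0 : ℝ), (ε, t) ∈ O :=
      (Continuous.prodMk_left t).continuousAt.preimage_mem_nhds (hO.mem_nhds hmem)
    filter_upwards [hev] with ε hε
    rw [← curveJet_add_smul r hct hη.contDiffAt]
    exact coords_ofCoords_curveJet hφ hψ (hct.add (contDiffAt_const.smul hη.contDiffAt)) hε.2
  have h3 := h1.congr_of_eventuallyEq h2.symm
  funext i
  have h4 := (hasDerivAt_pi.1 h3 i).deriv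
  rw [← h4]
  refine (deriv_iteratedDeriv_comm (Φ := fun ε τ => (ψ ∘ φ.symm) (c τ + ε • η τ))
    hO hΦ i (0, t) hmem).trans ?_
  refine Filter.EventuallyEq.iteratedDeriv_eq _ ?_
  have hev : ∀ᶠ τ in 𝓝 t, c τ ∈ (φ.symm ≫ₕ ψ).source :=
    hct.continuousAt.preimage_mem_nhds ((φ.symm ≫ₕ ψ).open_source.mem_nhds ht)
  filter_upwards [hev] with τ hτ
  refine (HasFDerivAt.comp_hasDerivAt (x := (0 : ℝ)) (f := fun ε : ℝ => c τ + ε • η τ)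
    (l := ψ ∘ φ.symm) ?_ (hcurve τ)).deriv
  rw [zero_smul, add_zero]
  exact (((contDiffOn_transition hφ hψ).contDiffAt
    ((φ.symm ≫ₕ ψ).open_source.mem_nhds hτ)).differentiableAt (by simp)).hasFDerivAt

end Jet

end JetCharts

theorem Jet.eventually_mem_source {E : Type*} [NormedAddCommGroup E] [NormedSpace ℝ E]
    {Q : Type*} [TopologicalSpace Q] [ChartedSpace E Q] (γ : SmoothCurve E Q) {U : Set Q}
    (hU : IsOpen U) {t : ℝ} (h : γ t ∈ U) : ∀ᶠ τ in 𝓝 t, γ τ ∈ U :=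
  γ.contMDiff.continuous.continuousAt.preimage_mem_nhds (hU.mem_nhds h)

/-! ### Lifts of curves and Tulczyjew's derivation -/

section TotalDerivative

variable {E : Type*} [NormedAddCommGroup E] [NormedSpace ℝ E]
  {Q : Type*} [TopologicalSpace Q] [ChartedSpace E Q] [IsManifold 𝓘(ℝ, E) ∞ Q]
  {F : Type*} [NormedAddCommGroup F] [NormedSpace ℝ F]

namespace Jet

variable {r k : ℕ} {φ ψ : OpenPartialHomeomorph Q E}

@[simp] theorem base_lift (r : ℕ) (γ : SmoothCurve E Q) (t : ℝ) : (lift r γ t).base = γ t := by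
  change γ (t + 0) = γ t
  rw [add_zero]

theorem proj_lift (h : r ≤ k) (γ : SmoothCurve E Q) (t : ℝ) :
    proj h (lift k γ t) = lift r γ t := rfl

theorem lift_rep_zero (x : Jet E Q r) : lift r x.rep 0 = x := by
  rw [lift_zero, mk_rep]

@[simp] theorem base_proj (h : r ≤ k) (x : Jet E Q k) : (proj h x).base = x.base := by
  rw [← lift_rep_zero x, proj_lift, base_lift, base_lift]

theorem coords_lift_eq_curveJet (hφ : φ ∈ IsManifold.maximalAtlas 𝓘(ℝ, E) ∞ Q)
    (γ : SmoothCurve E Q) {t : ℝ} (h : γ t ∈ φ.source) :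
    coords φ (lift r γ t) = curveJet r (φ ∘ γ) t :=
  funext fun i => coords_lift hφ γ h i

theorem coords_proj (hφ : φ ∈ IsManifold.maximalAtlas 𝓘(ℝ, E) ∞ Q) (h : r ≤ k) {x : Jet E Q k}
    (hx : x.base ∈ φ.source) (i : Fin (r + 1)) :
    coords φ (proj h x) i = coords φ x ⟨i, i.2.trans_le (Nat.succ_le_succ h)⟩ := by
  have h0 : x.rep 0 ∈ φ.source := by rwa [rep_zero]
  conv_lhs => rw [← lift_rep_zero x, proj_lift, coords_lift hφ _ h0]
  rfl

theorem contMDiffAt_lift (r : ℕ) (γ : SmoothCurve E Q) (t : ℝ) :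
    ContMDiffAt 𝓘(ℝ, ℝ) 𝓘(ℝ, Fin (r + 1) → E) ∞ (lift r γ) t := by
  have hφ : chartAt E (γ t) ∈ IsManifold.maximalAtlas 𝓘(ℝ, E) ∞ Q :=
    IsManifold.chart_mem_maximalAtlas _
  have hs := mem_chart_source E (γ t)
  have h1 : ContDiffAt ℝ ∞ (curveJet r (chartAt E (γ t) ∘ γ)) t :=
    contDiffAt_curveJet r (contDiffAt_chart_comp hφ γ hs)
  have h2 := contMDiffAt_ofCoords (r := r) hφ
    (v := curveJet r (chartAt E (γ t) ∘ γ) t) (by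
      rw [curveJet_zero]; exact (chartAt E (γ t)).map_source hs)
  refine (h2.comp t h1.contMDiffAt).congr_of_eventuallyEq ?_
  filter_upwards [eventually_mem_source γ (chartAt E (γ t)).open_source hs] with τ hτ
  rw [Function.comp_apply, ← coords_lift_eq_curveJet hφ γ hτ, ofCoords_coords hφ (by simpa using hτ)]

theorem contMDiffAt_proj (h : r ≤ k) (x : Jet E Q k) :
    ContMDiffAt 𝓘(ℝ, Fin (k + 1) → E) 𝓘(ℝ, Fin (r + 1) → E) ∞
      (proj h : Jet E Q k → Jet E Q r) x := by
  have hφ : chartAt E x.base ∈ IsManifold.maximalAtlas 𝓘(ℝ, E) ∞ Q :=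
    IsManifold.chart_mem_maximalAtlas _
  have hs := mem_chart_source E x.base
  let ρ : (Fin (k + 1) → E) → (Fin (r + 1) → E) :=
    fun v i => v ⟨i, i.2.trans_le (Nat.succ_le_succ h)⟩
  have hρ : ContDiff ℝ ∞ ρ := contDiff_pi.2 fun i => contDiff_apply _ _ _
  have h1 := contMDiffAt_ofCoords (r := r) hφ (v := ρ (coords (chartAt E x.base) x))
    (coords_zero_mem_target hs)
  refine (h1.comp x (hρ.contDiffAt.contMDiffAt.comp x
    (contMDiffAt_coords hφ hs))).congr_of_eventuallyEq ?_
  filter_upwards [eventually_base_mem (chartAt E x.base).open_source hs] with y hy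
  have hρy : ρ (coords (chartAt E x.base) y) = coords (chartAt E x.base) (proj h y) :=
    funext fun i => (coords_proj hφ h hy i).symm
  simp only [Function.comp_apply]
  rw [hρy, ofCoords_coords hφ (by simpa using hy)]

end Jet

open Jet

variable {r : ℕ} {φ ψ : OpenPartialHomeomorph Q E}

theorem dT_mk {f : Jet E Q r → F} (γ : SmoothCurve E Q)
    (hf : MDifferentiableAt 𝓘(ℝ, Fin (r + 1) → E) 𝓘(ℝ, F) f (lift r γ 0)) :
    HasDerivAt (f ∘ lift r γ) (dT f (mk (r + 1) γ)) 0 := by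
  have h := (hf.hasMFDerivAt.comp (0 : ℝ) ((contMDiffAt_lift r γ 0).mdifferentiableAt
    (by simp)).hasMFDerivAt)
  let D : ℝ →L[ℝ] F := ContinuousLinearMap.comp
    (show (Fin (r + 1) → E) →L[ℝ] F from
      mfderiv 𝓘(ℝ, Fin (r + 1) → E) 𝓘(ℝ, F) f (lift r γ 0))
    (show ℝ →L[ℝ] (Fin (r + 1) → E) from
      mfderiv 𝓘(ℝ, ℝ) 𝓘(ℝ, Fin (r + 1) → E) (lift r γ) 0)
  have h2 : HasFDerivAt (f ∘ lift r γ) D 0 := hasMFDerivAt_iff_hasFDerivAt.1 h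
  exact h2.hasDerivAt

/-- Translating the curve by `t` reduces this to time `0`, where `immersion` is by definition the
velocity of the lift. Thus `d_T` becomes ordinary differentiation along lifted curves. -/
theorem hasDerivAt_comp_lift {f : Jet E Q r → F} (γ : SmoothCurve E Q) {t : ℝ}
    (hf : MDifferentiableAt 𝓘(ℝ, Fin (r + 1) → E) 𝓘(ℝ, F) f (lift r γ t)) :
    HasDerivAt (f ∘ lift r γ) (dT f (lift (r + 1) γ t)) t := by
  have hshift : ∀ s, lift r (γ.shift t) s = lift r γ (t + s) := by
    intro s
    simp only [lift]
    congr 1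
    ext u
    simp [SmoothCurve.shift, add_assoc]
  have h := dT_mk (f := f) (γ.shift t) (by rwa [hshift, add_zero])
  have h2 : (f ∘ lift r (γ.shift t)) = fun s => (f ∘ lift r γ) (t + s) := by
    funext s
    simp [hshift]
  rw [h2] at h
  have h3 := HasDerivAt.comp_const_add (-t) t (f := fun s => (f ∘ lift r γ) (t + s))
    (by rwa [neg_add_cancel])
  simp only [add_neg_cancel_left] at h3
  exact h3

/-- The total derivative in natural coordinates. -/
theorem dT_eq_fderiv (hφ : φ ∈ IsManifold.maximalAtlas 𝓘(ℝ, E) ∞ Q) {f : Jet E Q r → F}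
    {x : Jet E Q (r + 1)} (hx : x.base ∈ φ.source)
    (hf : MDifferentiableAt 𝓘(ℝ, Fin (r + 1) → E) 𝓘(ℝ, F) f (proj r.le_succ x)) :
    dT f x = fderiv ℝ (f ∘ ofCoords φ) (fun i => coords φ x i.castSucc)
      (fun i => coords φ x i.succ) := by
  have h0 : x.rep 0 ∈ φ.source := by rwa [rep_zero]
  have hlift : lift r x.rep 0 = proj r.le_succ x := by
    conv_rhs => rw [← lift_rep_zero x, proj_lift]
  have h1 := hasDerivAt_comp_lift (f := f) x.rep (t := 0) (by rwa [hlift])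
  rw [lift_rep_zero] at h1
  have hc := contDiffAt_chart_comp hφ x.rep h0
  have hcj : curveJet r (φ ∘ x.rep) 0 = coords φ (proj r.le_succ x) := by
    rw [← hlift, coords_lift_eq_curveJet hφ _ h0]
  have hpb : (proj r.le_succ x).base ∈ φ.source := by simpa using hx
  have hg : DifferentiableAt ℝ (f ∘ ofCoords φ) (curveJet r (φ ∘ x.rep) 0) := by
    rw [← mdifferentiableAt_iff_differentiableAt]
    refine MDifferentiableAt.comp _ (I' := 𝓘(ℝ, Fin (r + 1) → E)) ?_
      ((contMDiffAt_ofCoords hφ ?_).mdifferentiableAt (by simp))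
    · rwa [hcj, ofCoords_coords hφ hpb]
    · rw [hcj]; exact coords_zero_mem_target hpb
  have h2 := HasFDerivAt.comp_hasDerivAt (x := (0 : ℝ)) (f := curveJet r (φ ∘ x.rep))
    (l := f ∘ ofCoords φ) hg.hasFDerivAt (hasDerivAt_curveJet r hc)
  have h3 : f ∘ lift r x.rep =ᶠ[𝓝 0] (f ∘ ofCoords φ) ∘ curveJet r (φ ∘ x.rep) := by
    filter_upwards [eventually_mem_source x.rep φ.open_source h0] with τ hτ
    simp only [Function.comp_apply]
    rw [← coords_lift_eq_curveJet hφ _ hτ, ofCoords_coords hφ (by simpa using hτ)]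
  rw [h1.unique (h2.congr_of_eventuallyEq h3), hcj]
  congr 1
  · congr 1
    exact funext fun i => coords_proj hφ _ hx i
  · funext i
    simp only [curveJet, ← iteratedDeriv_succ']
    rfl

theorem contDiffAt_comp_ofCoords (hφ : φ ∈ IsManifold.maximalAtlas 𝓘(ℝ, E) ∞ Q)
    {f : Jet E Q r → F} {x : Jet E Q r} (hx : x.base ∈ φ.source)
    (hf : ContMDiffAt 𝓘(ℝ, Fin (r + 1) → E) 𝓘(ℝ, F) ∞ f x) :
    ContDiffAt ℝ ∞ (f ∘ ofCoords φ) (coords φ x) := by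
  rw [← contMDiffAt_iff_contDiffAt]
  refine ContMDiffAt.comp _ (I' := 𝓘(ℝ, Fin (r + 1) → E)) ?_
    (contMDiffAt_ofCoords hφ (coords_zero_mem_target hx))
  rwa [ofCoords_coords hφ hx]

/-- The statement is local over `U ⊆ Q` because it is applied to the partial derivatives of `L`,
whose smoothness is available only over the domain of the chart. -/
theorem contMDiffAt_dT {f : Jet E Q r → F} {U : Set Q} (hU : IsOpen U)
    (hf : ∀ x : Jet E Q r, x.base ∈ U → ContMDiffAt 𝓘(ℝ, Fin (r + 1) → E) 𝓘(ℝ, F) ∞ f x)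
    (x : Jet E Q (r + 1)) (hx : x.base ∈ U) :
    ContMDiffAt 𝓘(ℝ, Fin (r + 1 + 1) → E) 𝓘(ℝ, F) ∞ (dT f) x := by
  have hφ : chartAt E x.base ∈ IsManifold.maximalAtlas 𝓘(ℝ, E) ∞ Q :=
    IsManifold.chart_mem_maximalAtlas _
  have hs := mem_chart_source E x.base
  have hρ1 : ContDiff ℝ ∞ (fun (v : Fin (r + 1 + 1) → E) (i : Fin (r + 1)) => v i.castSucc) :=
    contDiff_pi.2 fun i => contDiff_apply _ _ _
  have hρ2 : ContDiff ℝ ∞ (fun (v : Fin (r + 1 + 1) → E) (i : Fin (r + 1)) => v i.succ) :=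
    contDiff_pi.2 fun i => contDiff_apply _ _ _
  have hpc : (fun i : Fin (r + 1) => coords (chartAt E x.base) x i.castSucc) =
      coords (chartAt E x.base) (proj r.le_succ x) :=
    funext fun i => (coords_proj hφ _ hs i).symm
  have hg : ContDiffAt ℝ ∞ (fun v : Fin (r + 1 + 1) → E =>
      fderiv ℝ (f ∘ ofCoords (chartAt E x.base)) (fun i => v i.castSucc) (fun i => v i.succ))
      (coords (chartAt E x.base) x) := by
    refine ContDiffAt.clm_apply ?_ hρ2.contDiffAt
    refine ContDiffAt.comp (g := fderiv ℝ (f ∘ ofCoords (chartAt E x.base))) _ ?_ hρ1.contDiffAt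
    rw [hpc]
    exact (contDiffAt_comp_ofCoords hφ (by simp)
      (hf _ (by simpa using hx))).fderiv_right (by simp)
  refine (hg.contMDiffAt.comp x (contMDiffAt_coords hφ hs)).congr_of_eventuallyEq ?_
  filter_upwards [eventually_base_mem hU hx,
    eventually_base_mem (chartAt E x.base).open_source hs] with y hy hy'
  exact dT_eq_fderiv hφ hy' ((hf _ (by simpa using hy)).mdifferentiableAt (by simp))

theorem contMDiffAt_dTIter {f : Jet E Q r → F} {U : Set Q} (hU : IsOpen U)
    (hf : ∀ x : Jet E Q r, x.base ∈ U → ContMDiffAt 𝓘(ℝ, Fin (r + 1) → E) 𝓘(ℝ, F) ∞ f x)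
    (j : ℕ) : ∀ x : Jet E Q (r + j), x.base ∈ U →
    ContMDiffAt 𝓘(ℝ, Fin (r + j + 1) → E) 𝓘(ℝ, F) ∞ (dTIter f j) x := by
  induction j with
  | zero => exact hf
  | succ j ih => exact contMDiffAt_dT hU ih

theorem dTIter_lift {f : Jet E Q r → F} {U : Set Q} (hU : IsOpen U)
    (hf : ∀ x : Jet E Q r, x.base ∈ U → ContMDiffAt 𝓘(ℝ, Fin (r + 1) → E) 𝓘(ℝ, F) ∞ f x)
    (γ : SmoothCurve E Q) (j : ℕ) : ∀ t : ℝ, γ t ∈ U →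
    dTIter f j (lift (r + j) γ t) = iteratedDeriv j (f ∘ lift r γ) t := by
  induction j with
  | zero => intro t _; simp [dTIter]
  | succ j ih =>
    intro t ht
    have h1 := hasDerivAt_comp_lift (f := dTIter f j) γ (t := t)
      ((contMDiffAt_dTIter hU hf j _ (by simpa using ht)).mdifferentiableAt (by simp))
    have h2 : dTIter f j ∘ lift (r + j) γ =ᶠ[𝓝 t] iteratedDeriv j (f ∘ lift r γ) := by
      filter_upwards [eventually_mem_source γ hU ht] with τ hτ using ih τ hτ
    rw [iteratedDeriv_succ, ← h2.deriv_eq]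
    exact h1.deriv.symm

end TotalDerivative

/-! ### Ostrogradsky momenta, first variation and independence of the chart -/

section Momenta

variable {E : Type*} [NormedAddCommGroup E] [NormedSpace ℝ E]
  {Q : Type*} [TopologicalSpace Q] [ChartedSpace E Q] [IsManifold 𝓘(ℝ, E) ∞ Q]

open Jet

variable {m : ℕ} {φ ψ : OpenPartialHomeomorph Q E} {L : Jet E Q (m + 1) → ℝ}

theorem contMDiffAt_partialDeriv {r : ℕ} (hφ : φ ∈ IsManifold.maximalAtlas 𝓘(ℝ, E) ∞ Q)
    {f : Jet E Q r → ℝ} (hf : ContMDiff 𝓘(ℝ, Fin (r + 1) → E) 𝓘(ℝ, ℝ) ∞ f) (i : Fin (r + 1))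
    (x : Jet E Q r) (hx : x.base ∈ φ.source) :
    ContMDiffAt 𝓘(ℝ, Fin (r + 1) → E) 𝓘(ℝ, E →L[ℝ] ℝ) ∞ (partialDeriv φ i f) x := by
  have h1 : ContDiffAt ℝ ∞ (fun v : Fin (r + 1) → E => (fderiv ℝ (f ∘ ofCoords φ) v).comp
      (ContinuousLinearMap.single ℝ (fun _ : Fin (r + 1) => E) i)) (coords φ x) :=
    ((contDiffAt_comp_ofCoords hφ hx hf.contMDiffAt).fderiv_right (m := ∞) (by simp)).clm_comp
      contDiffAt_const
  exact h1.contMDiffAt.comp x (contMDiffAt_coords hφ hx)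

theorem contMDiffAt_ostrogradskyMomentum (hφ : φ ∈ IsManifold.maximalAtlas 𝓘(ℝ, E) ∞ Q)
    (hL : ContMDiff 𝓘(ℝ, Fin (m + 1 + 1) → E) 𝓘(ℝ, ℝ) ∞ L) (s : Fin (m + 1))
    {w : Jet E Q (2 * m + 1)} (hw : w.base ∈ φ.source) :
    ContMDiffAt 𝓘(ℝ, Fin (2 * m + 1 + 1) → E) 𝓘(ℝ, E →L[ℝ] ℝ) ∞
      (ostrogradskyMomentum φ L s) w := by
  unfold ostrogradskyMomentum
  refine contMDiffAt_finsetSum fun j _ => ?_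
  refine (contMDiffAt_const : ContMDiffAt 𝓘(ℝ, Fin (2 * m + 1 + 1) → E) 𝓘(ℝ, ℝ) ∞
    (fun _ => (-1 : ℝ) ^ (j : ℕ)) w).smul ?_
  refine ContMDiffAt.comp w (contMDiffAt_dTIter φ.open_source
    (fun x hx => contMDiffAt_partialDeriv hφ hL _ x hx) _ _ ?_) (contMDiffAt_proj _ w)
  simpa using hw

/-- The coefficients `∂L/∂q_(i)` along the lift of a curve. -/
def lagrangianCoeff (φ : OpenPartialHomeomorph Q E) (L : Jet E Q (m + 1) → ℝ)
    (γ : SmoothCurve E Q) (i : ℕ) (t : ℝ) : E →L[ℝ] ℝ :=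
  -- The value `0` beyond order `k = m + 1` is never reached by the alternating sums: their indices
  -- `s + 1 + j` with `j < k - s` are at most `k`.
  if h : i < m + 1 + 1 then partialDeriv φ ⟨i, h⟩ L (lift (m + 1) γ t) else 0

theorem contDiffAt_lagrangianCoeff (hφ : φ ∈ IsManifold.maximalAtlas 𝓘(ℝ, E) ∞ Q)
    (hL : ContMDiff 𝓘(ℝ, Fin (m + 1 + 1) → E) 𝓘(ℝ, ℝ) ∞ L) (γ : SmoothCurve E Q) {t : ℝ}
    (ht : γ t ∈ φ.source) (i : ℕ) : ContDiffAt ℝ ∞ (lagrangianCoeff φ L γ i) t := by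
  unfold lagrangianCoeff
  split_ifs with h
  · rw [← contMDiffAt_iff_contDiffAt]
    exact (contMDiffAt_partialDeriv hφ hL ⟨i, h⟩ _ (by simpa using ht)).comp t
      (contMDiffAt_lift (m + 1) γ t)
  · exact contDiffAt_const

/-- Every `d_T^j` turns into the `j`-th time derivative along the lift, so integration by parts for
curves applies to the momenta. -/
theorem ostrogradskyMomentum_lift (hφ : φ ∈ IsManifold.maximalAtlas 𝓘(ℝ, E) ∞ Q)
    (hL : ContMDiff 𝓘(ℝ, Fin (m + 1 + 1) → E) 𝓘(ℝ, ℝ) ∞ L) (γ : SmoothCurve E Q) {t : ℝ}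
    (ht : γ t ∈ φ.source) (s : Fin (m + 1)) :
    ostrogradskyMomentum φ L s (lift (2 * m + 1) γ t) =
      alternatingSum (lagrangianCoeff φ L γ) (m + 1) s t := by
  rw [ostrogradskyMomentum, alternatingSum, ← Fin.sum_univ_eq_sum_range
    (fun j => (-1 : ℝ) ^ j • iteratedDeriv j (lagrangianCoeff φ L γ (s + 1 + j)) t)]
  refine Finset.sum_congr rfl fun j _ => ?_
  rw [proj_lift, dTIter_lift φ.open_source
    (fun x hx => contMDiffAt_partialDeriv hφ hL _ x hx) γ j t ht]
  congr 2
  funext τ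
  rw [lagrangianCoeff, dif_pos (by omega)]
  rfl

/-- The covector `∑ₛ p̂^(s) dq_(s)` in the natural coordinates induced by `φ`. -/
def momentumForm (φ : OpenPartialHomeomorph Q E) (L : Jet E Q (m + 1) → ℝ)
    (w : Jet E Q (2 * m + 1)) : (Fin (m + 1) → E) →L[ℝ] ℝ :=
  ∑ s : Fin (m + 1), (ostrogradskyMomentum φ L s w).comp
    (ContinuousLinearMap.proj (R := ℝ) (φ := fun _ : Fin (m + 1) => E) s)

theorem momentumForm_apply (w : Jet E Q (2 * m + 1)) (v : Fin (m + 1) → E) :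
    momentumForm φ L w v = ∑ s : Fin (m + 1), ostrogradskyMomentum φ L s w (v s) := by
  simp [momentumForm]

theorem contMDiffAt_momentumForm (hφ : φ ∈ IsManifold.maximalAtlas 𝓘(ℝ, E) ∞ Q)
    (hL : ContMDiff 𝓘(ℝ, Fin (m + 1 + 1) → E) 𝓘(ℝ, ℝ) ∞ L)
    {w : Jet E Q (2 * m + 1)} (hw : w.base ∈ φ.source) :
    ContMDiffAt 𝓘(ℝ, Fin (2 * m + 1 + 1) → E) 𝓘(ℝ, (Fin (m + 1) → E) →L[ℝ] ℝ) ∞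
      (momentumForm φ L) w :=
  contMDiffAt_finsetSum fun s _ =>
    (contMDiffAt_ostrogradskyMomentum hφ hL s hw).clm_comp contMDiffAt_const

/-- The first variation formula, at points where the variation vanishes. -/
theorem hasDerivAt_momentumForm_lift (hφ : φ ∈ IsManifold.maximalAtlas 𝓘(ℝ, E) ∞ Q)
    (hL : ContMDiff 𝓘(ℝ, Fin (m + 1 + 1) → E) 𝓘(ℝ, ℝ) ∞ L) (γ : SmoothCurve E Q) {t : ℝ}
    (ht : γ t ∈ φ.source) {η : ℝ → E} (hη : ContDiffAt ℝ ∞ η t) (h0 : η t = 0) :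
    HasDerivAt (fun τ => momentumForm φ L (lift (2 * m + 1) γ τ) (curveJet m η τ))
      (fderiv ℝ (L ∘ ofCoords φ) (curveJet (m + 1) (φ ∘ γ) t) (curveJet (m + 1) η t)) t := by
  have h := hasDerivAt_sum_alternatingSum
    (fun i => contDiffAt_lagrangianCoeff hφ hL γ ht i) hη h0 (m + 1)
  have e1 : fderiv ℝ (L ∘ ofCoords φ) (curveJet (m + 1) (φ ∘ γ) t) (curveJet (m + 1) η t) =
      ∑ i ∈ Finset.range (m + 1 + 1), lagrangianCoeff φ L γ i t (iteratedDeriv i η t) := by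
    rw [← Fin.sum_univ_eq_sum_range
      (fun i => lagrangianCoeff φ L γ i t (iteratedDeriv i η t))]
    conv_lhs => rw [← Finset.univ_sum_single (curveJet (m + 1) η t), map_sum]
    refine Finset.sum_congr rfl fun i _ => ?_
    rw [lagrangianCoeff, dif_pos i.2, partialDeriv, coords_lift_eq_curveJet hφ γ ht]
    rfl
  rw [e1]
  refine h.congr_of_eventuallyEq ?_
  filter_upwards [eventually_mem_source γ φ.open_source ht] with τ hτ
  rw [momentumForm_apply, ← Fin.sum_univ_eq_sum_range
    (fun s => alternatingSum (lagrangianCoeff φ L γ) (m + 1) s τ (iteratedDeriv s η τ))]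
  refine Finset.sum_congr rfl fun s _ => ?_
  rw [ostrogradskyMomentum_lift hφ hL γ hτ]
  rfl

/-- The covector `∑ₛ p̂^(s) dq_(s)` does not depend on the chart. -/
theorem momentumForm_eq_comp (hφ : φ ∈ IsManifold.maximalAtlas 𝓘(ℝ, E) ∞ Q)
    (hψ : ψ ∈ IsManifold.maximalAtlas 𝓘(ℝ, E) ∞ Q)
    (hL : ContMDiff 𝓘(ℝ, Fin (m + 1 + 1) → E) 𝓘(ℝ, ℝ) ∞ L)
    {w : Jet E Q (2 * m + 1)} (hw : w.base ∈ φ.source) (hw' : w.base ∈ ψ.source) :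
    momentumForm φ L w = (momentumForm ψ L w).comp
      (fderiv ℝ (fun v : Fin (m + 1) → E => coords ψ (ofCoords φ v : Jet E Q m))
        (coords φ (proj (show m ≤ 2 * m + 1 by omega) w))) := by
  set γ := w.rep with hγ
  set c : ℝ → E := φ ∘ γ with hcdef
  let I : Set ℝ := γ ⁻¹' (φ.source ∩ ψ.source)
  have hI : IsOpen I :=
    (φ.open_source.inter ψ.open_source).preimage γ.contMDiff.continuous
  have hc : ContDiffOn ℝ ∞ c I := fun τ hτ =>
    (contDiffAt_chart_comp hφ γ hτ.1).contDiffWithinAt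
  have hcI : ∀ τ ∈ I, c τ ∈ (φ.symm ≫ₕ ψ).source := by
    intro τ hτ
    simp [hcdef, φ.map_source hτ.1, φ.left_inv hτ.1, hτ.2]
  have hG : ∀ r : ℕ, ∀ τ ∈ I, ContDiffAt ℝ ∞ (fun v : Fin (r + 1) → E =>
      coords ψ (ofCoords φ v : Jet E Q r)) (curveJet r c τ) := fun r τ hτ =>
    contDiffAt_coords_ofCoords hφ hψ (by rw [curveJet_zero]; exact hcI τ hτ)
  have hGc : ∀ r : ℕ, ∀ τ ∈ I,
      coords ψ (ofCoords φ (curveJet r c τ) : Jet E Q r) = curveJet r (ψ ∘ γ) τ := by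
    intro r τ hτ
    rw [← coords_lift_eq_curveJet hφ γ hτ.1, ofCoords_coords hφ (by simpa using hτ.1),
      coords_lift_eq_curveJet hψ γ hτ.2]
  -- The discrepancy between the two charts at all times near `0`, not only at `0`: the vanishing
  -- argument differentiates it.
  let b : ℝ → (Fin (m + 1) → E) →L[ℝ] ℝ := fun τ =>
    momentumForm φ L (lift (2 * m + 1) γ τ) - (momentumForm ψ L (lift (2 * m + 1) γ τ)).comp
      (fderiv ℝ (fun v : Fin (m + 1) → E => coords ψ (ofCoords φ v : Jet E Q m)) (curveJet m c τ))
  have hform : ∀ χ ∈ IsManifold.maximalAtlas 𝓘(ℝ, E) ∞ Q, ∀ τ, γ τ ∈ χ.source →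
      DifferentiableAt ℝ (fun τ => momentumForm χ L (lift (2 * m + 1) γ τ)) τ := by
    intro χ hχ τ hτ
    have : ContMDiffAt 𝓘(ℝ, ℝ) 𝓘(ℝ, (Fin (m + 1) → E) →L[ℝ] ℝ) ∞
        (fun τ => momentumForm χ L (lift (2 * m + 1) γ τ)) τ :=
      (contMDiffAt_momentumForm hχ hL (by simpa using hτ)).comp τ (contMDiffAt_lift _ γ τ)
    exact (contMDiffAt_iff_contDiffAt.1 this).differentiableAt (by simp)
  have hb : ∀ τ ∈ I, DifferentiableAt ℝ b τ := by
    intro τ hτ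
    refine (hform φ hφ τ hτ.1).sub ((hform ψ hψ τ hτ.2).clm_comp ?_)
    have h1 : DifferentiableAt ℝ (fderiv ℝ (fun v : Fin (m + 1) → E =>
        coords ψ (ofCoords φ v : Jet E Q m))) (curveJet m c τ) :=
      ((hG m τ hτ).fderiv_right (m := ∞) (by simp)).differentiableAt (by simp)
    exact h1.comp τ ((contDiffAt_curveJet m (hc.contDiffAt (hI.mem_nhds hτ))).differentiableAt
      (by simp))
  have hzero : ∀ τ ∈ I, b τ = 0 := by
    refine eq_zero_of_hasDerivAt_curveJet hI hb fun η hη t ht h0 => ?_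
    -- The same variation seen in the chart `ψ`. It vanishes where `η` does, so the first variation
    -- formula applies in both charts.
    let η' : ℝ → E := fun τ => fderiv ℝ (ψ ∘ φ.symm) (c τ) (η τ)
    have hη' : ContDiffAt ℝ ∞ η' t := by
      refine ContDiffAt.clm_apply ?_ hη.contDiffAt
      refine ContDiffAt.comp (g := fderiv ℝ (ψ ∘ φ.symm)) t ?_ (hc.contDiffAt (hI.mem_nhds ht))
      exact ((contDiffOn_transition hφ hψ).contDiffAt
        ((φ.symm ≫ₕ ψ).open_source.mem_nhds (hcI t ht))).fderiv_right (by simp)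
    have h0' : η' t = 0 := by simp [η', h0]
    have hd := (hasDerivAt_momentumForm_lift hφ hL γ ht.1 hη.contDiffAt h0).sub
      (hasDerivAt_momentumForm_lift hψ hL γ ht.2 hη' h0')
    have hLG : L ∘ ofCoords φ =ᶠ[𝓝 (curveJet (m + 1) c t)] (L ∘ ofCoords ψ) ∘
        (fun v : Fin (m + 1 + 1) → E => coords ψ (ofCoords φ v : Jet E Q (m + 1))) := by
      filter_upwards [(isOpen_trans_source φ ψ (m + 1)).mem_nhds
        (show curveJet (m + 1) c t 0 ∈ _ by rw [curveJet_zero]; exact hcI t ht)] with v hv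
      have hv' : v 0 ∈ φ.target ∧ φ.symm (v 0) ∈ ψ.source := by simpa using hv
      simp only [Function.comp_apply]
      rw [ofCoords_coords hψ (by rw [base_ofCoords hφ hv'.1]; exact hv'.2)]
    have hLψ : DifferentiableAt ℝ (L ∘ ofCoords ψ)
        (coords ψ (ofCoords φ (curveJet (m + 1) c t) : Jet E Q (m + 1))) := by
      rw [hGc (m + 1) t ht, ← coords_lift_eq_curveJet hψ γ ht.2]
      exact (contDiffAt_comp_ofCoords hψ (by simpa using ht.2) hL.contMDiffAt).differentiableAt
        (by simp)
    -- Both first variations equal the intrinsic derivative of `L` along the variation, by the chain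
    -- rule for the change of coordinates on `k`-jets.
    have e1 : fderiv ℝ (L ∘ ofCoords φ) (curveJet (m + 1) c t) (curveJet (m + 1) η t) =
        fderiv ℝ (L ∘ ofCoords ψ) (curveJet (m + 1) (ψ ∘ γ) t) (curveJet (m + 1) η' t) := by
      rw [hLG.fderiv_eq, fderiv_comp (curveJet (m + 1) c t)
          (f := fun v : Fin (m + 1 + 1) → E => coords ψ (ofCoords φ v : Jet E Q (m + 1)))
          (g := L ∘ ofCoords ψ) hLψ ((hG (m + 1) t ht).differentiableAt (by simp)),
        ContinuousLinearMap.comp_apply, hGc (m + 1) t ht,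
        fderiv_coords_ofCoords_curveJet hφ hψ hI ht hc hη (hcI t ht)]
    rw [e1, sub_self] at hd
    refine hd.congr_of_eventuallyEq ?_
    filter_upwards [hI.mem_nhds ht] with τ hτ
    simp only [b, sub_apply, ContinuousLinearMap.comp_apply, Pi.sub_apply]
    rw [fderiv_coords_ofCoords_curveJet hφ hψ hI hτ hc hη (hcI τ hτ)]
  have hmem : (0 : ℝ) ∈ I := by
    change γ 0 ∈ φ.source ∩ ψ.source
    rw [hγ, rep_zero]
    exact ⟨hw, hw'⟩
  have hfin := sub_eq_zero.1 (hzero 0 hmem)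
  have hp : proj (show m ≤ 2 * m + 1 by omega) w = lift m γ 0 := by
    conv_lhs => rw [← lift_rep_zero w, proj_lift]
  rw [hγ, lift_rep_zero] at hfin
  rw [hfin, hp, coords_lift_eq_curveJet hφ γ hmem.1]

end Momenta

/-! ### Cotangent fibers and the envelope formula -/

section CotangentFiber

variable {V : Type*} [NormedAddCommGroup V] [NormedSpace ℝ V]
  {M : Type*} [TopologicalSpace M] [ChartedSpace V M] [IsManifold 𝓘(ℝ, V) ∞ M]

/-- The inclusion of a fiber in the cotangent bundle is smooth. -/
theorem contMDiff_cotangent_mk (x : M) :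
    ContMDiff 𝓘(ℝ, V →L[ℝ] ℝ) (𝓘(ℝ, V).prod 𝓘(ℝ, V →L[ℝ] ℝ)) ∞
      (fun β : V →L[ℝ] ℝ => (⟨x, β⟩ : Cotangent V M)) := by
  intro β
  rw [contMDiffAt_totalSpace]
  refine ⟨contMDiffAt_const, ?_⟩
  let T := trivializationAt (V →L[ℝ] ℝ)
    (fun x : M => TangentSpace 𝓘(ℝ, V) x →L[ℝ] Trivial M ℝ x) x
  let A : (V →L[ℝ] ℝ) →L[ℝ] (V →L[ℝ] ℝ) := T.continuousLinearMapAt ℝ x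
  -- On a single fiber the trivialization is a continuous linear map, hence smooth.
  have hA : (fun β : V →L[ℝ] ℝ => (T (⟨x, β⟩ : Cotangent V M)).2) = A := by
    funext β
    exact (congrFun (T.coe_linearMapAt_of_mem (R := ℝ)
      (FiberBundle.mem_baseSet_trivializationAt' x)) β).symm
  change ContMDiffAt _ _ _ (fun β : V →L[ℝ] ℝ => (T (⟨x, β⟩ : Cotangent V M)).2) β
  rw [hA]
  exact A.contDiff.contDiffAt.contMDiffAt

/-- Envelope formula for the derivative of a Legendre transform. -/
theorem hasFDerivAt_legendre {E : Type*} [NormedAddCommGroup E] [NormedSpace ℝ E]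
    {u : (V →L[ℝ] ℝ) → E} {β : V →L[ℝ] ℝ} (hu : DifferentiableAt ℝ u β) (v : V) (ι : E →L[ℝ] V)
    {g : E → ℝ} (hg : HasFDerivAt g (β.comp ι) (u β)) :
    HasFDerivAt (fun δ : V →L[ℝ] ℝ => δ (v + ι (u δ)) - g (u δ))
      (NormedSpace.inclusionInDoubleDual ℝ V (v + ι (u β))) β := by
  have h1 : HasFDerivAt (fun δ => v + ι (u δ)) (ι.comp (fderiv ℝ u β)) β :=
    (ι.hasFDerivAt.comp β hu.hasFDerivAt).const_add v
  have h2 := ((hasFDerivAt_id β).clm_apply h1).sub (hg.comp β hu.hasFDerivAt)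
  -- The two terms containing the derivative of `u` are both `β ∘ ι` applied to it, with opposite
  -- signs.
  refine h2.congr_fderiv ?_
  ext δ
  simp

end CotangentFiber

/-! ### Separating the highest-order slot -/

section Snoc

variable {E : Type*} [NormedAddCommGroup E] [NormedSpace ℝ E]

/-- Exhibits the tuple as affine in its last entry, the shape `v + ι u` required by the envelope
formula. -/
theorem snoc_eq_add_single {n : ℕ} (q : Fin n → E) (u : E) :
    (Fin.snoc q u : Fin (n + 1) → E) = (Fin.snoc q 0 : Fin (n + 1) → E) +
      ContinuousLinearMap.single ℝ (fun _ : Fin (n + 1) => E) (Fin.last n) u := by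
  funext i
  refine Fin.lastCases ?_ (fun j => ?_) i
  · simp
  · simp [(Fin.castSucc_lt_last j).ne]

theorem hasFDerivAt_snoc {n : ℕ} (q : Fin n → E) (u : E) :
    HasFDerivAt (fun u : E => (Fin.snoc q u : Fin (n + 1) → E))
      (ContinuousLinearMap.single ℝ (fun _ : Fin (n + 1) => E) (Fin.last n)) u := by
  have h := (ContinuousLinearMap.single ℝ (fun _ : Fin (n + 1) => E)
    (Fin.last n)).hasFDerivAt.const_add (x := u) (Fin.snoc q 0 : Fin (n + 1) → E)
  exact h.congr_of_eventuallyEq (Eventually.of_forall fun u => snoc_eq_add_single q u)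

theorem apply_snoc {n : ℕ} (δ : (Fin (n + 1) → E) →L[ℝ] ℝ) (q : Fin n → E) (u : E) :
    δ (Fin.snoc q u) = ∑ j : Fin n, δ (Pi.single (M := fun _ : Fin (n + 1) => E) j.castSucc (q j)) +
      δ (Pi.single (M := fun _ : Fin (n + 1) => E) (Fin.last n) u) := by
  conv_lhs => rw [← Finset.univ_sum_single (Fin.snoc q u : Fin (n + 1) → E), map_sum,
    Fin.sum_univ_castSucc]
  simp

end Snoc

/-! ### The Legendre-Ostrogradsky map, the energy and holonomy -/

section LegendreOstrogradsky

variable {E : Type*} [NormedAddCommGroup E] [NormedSpace ℝ E]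
  {Q : Type*} [TopologicalSpace Q] [ChartedSpace E Q] [IsManifold 𝓘(ℝ, E) ∞ Q]

open Jet

variable {m : ℕ} {φ ψ : OpenPartialHomeomorph Q E} {L : Jet E Q (m + 1) → ℝ}

/-- The velocity components `(q_(1), …, q_(k))` of an element of `T^{(2k-1)}Q`. -/
def velocityCoords (φ : OpenPartialHomeomorph Q E) (w : Jet E Q (2 * m + 1)) : Fin (m + 1) → E :=
  fun s => coords φ w ⟨s + 1, by omega⟩

/-- The shifted coordinates are the velocity at `0` of the lifted curve in `T^{(k-1)}Q`, so they
transform as a tangent vector. -/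
theorem fderiv_velocityCoords (hφ : φ ∈ IsManifold.maximalAtlas 𝓘(ℝ, E) ∞ Q)
    (hψ : ψ ∈ IsManifold.maximalAtlas 𝓘(ℝ, E) ∞ Q)
    {w : Jet E Q (2 * m + 1)} (hw : w.base ∈ φ.source) (hw' : w.base ∈ ψ.source) :
    fderiv ℝ (fun v : Fin (m + 1) → E => coords ψ (ofCoords φ v : Jet E Q m))
      (coords φ (proj (show m ≤ 2 * m + 1 by omega) w)) (velocityCoords φ w) =
      velocityCoords ψ w := by
  have h0 : w.rep 0 ∈ φ.source := by rwa [rep_zero]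
  have h0' : w.rep 0 ∈ ψ.source := by rwa [rep_zero]
  have hp : proj (show m ≤ 2 * m + 1 by omega) w = lift m w.rep 0 := by
    conv_lhs => rw [← lift_rep_zero w, proj_lift]
  have hvel : ∀ χ ∈ IsManifold.maximalAtlas 𝓘(ℝ, E) ∞ Q, w.rep 0 ∈ χ.source →
      HasDerivAt (curveJet m (χ ∘ w.rep)) (velocityCoords χ w) 0 := by
    intro χ hχ hs
    convert hasDerivAt_curveJet m (contDiffAt_chart_comp hχ w.rep hs) using 1
    funext s
    simp only [curveJet, ← iteratedDeriv_succ']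
    rfl
  have hG : DifferentiableAt ℝ (fun v : Fin (m + 1) → E => coords ψ (ofCoords φ v : Jet E Q m))
      (curveJet m (φ ∘ w.rep) 0) := by
    rw [← coords_lift_eq_curveJet hφ _ h0, ← hp]
    exact (contDiffAt_coords_ofCoords hφ hψ (coords_zero_mem_trans_source (by simpa using hw)
      (by simpa using hw'))).differentiableAt (by simp)
  have h1 := HasFDerivAt.comp_hasDerivAt (x := (0 : ℝ)) (f := curveJet m (φ ∘ w.rep))
    (l := fun v : Fin (m + 1) → E => coords ψ (ofCoords φ v : Jet E Q m)) hG.hasFDerivAt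
    (hvel φ hφ h0)
  have h2 : curveJet m (ψ ∘ w.rep) =ᶠ[𝓝 0]
      (fun v : Fin (m + 1) → E => coords ψ (ofCoords φ v : Jet E Q m)) ∘
        curveJet m (φ ∘ w.rep) := by
    filter_upwards [eventually_mem_source w.rep φ.open_source h0,
      eventually_mem_source w.rep ψ.open_source h0'] with τ hτ hτ'
    simp only [Function.comp_apply]
    rw [← coords_lift_eq_curveJet hφ _ hτ, ofCoords_coords hφ (by simpa using hτ),
      coords_lift_eq_curveJet hψ _ hτ']
  rw [hp, coords_lift_eq_curveJet hφ _ h0]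
  exact (h1.congr_of_eventuallyEq h2).unique (hvel ψ hψ h0')

/-- The Legendre-Ostrogradsky map in the natural coordinates induced by an arbitrary chart. -/
theorem legendreOstrogradsky_snd (hφ : φ ∈ IsManifold.maximalAtlas 𝓘(ℝ, E) ∞ Q)
    (hL : ContMDiff 𝓘(ℝ, Fin (m + 1 + 1) → E) 𝓘(ℝ, ℝ) ∞ L)
    {w : Jet E Q (2 * m + 1)} (hw : w.base ∈ φ.source) :
    (show (Fin (m + 1) → E) →L[ℝ] ℝ from (legendreOstrogradsky L w).snd) =
      (momentumForm φ L w).comp (coordsDeriv φ (proj (show m ≤ 2 * m + 1 by omega) w)) := by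
  have hc : chartAt E w.base ∈ IsManifold.maximalAtlas 𝓘(ℝ, E) ∞ Q :=
    IsManifold.chart_mem_maximalAtlas _
  have hs := mem_chart_source E w.base
  have h1 : (show (Fin (m + 1) → E) →L[ℝ] ℝ from (legendreOstrogradsky L w).snd) =
      (momentumForm (chartAt E w.base) L w).comp
        (coordsDeriv (chartAt E w.base) (proj (show m ≤ 2 * m + 1 by omega) w)) := by
    let B : Fin (m + 1) → (Fin (m + 1) → E) →L[ℝ] E := fun s =>
      mfderiv 𝓘(ℝ, Fin (m + 1) → E) 𝓘(ℝ, E) (fun y : Jet E Q m => coords (chartAt E w.base) y s)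
        (proj (show m ≤ 2 * m + 1 by omega) w)
    have hB : ∀ s, B s = (ContinuousLinearMap.proj (R := ℝ) (φ := fun _ : Fin (m + 1) => E) s).comp
        (coordsDeriv (chartAt E w.base) (proj (show m ≤ 2 * m + 1 by omega) w)) := fun s =>
      mfderiv_coords_apply hc (x := proj (show m ≤ 2 * m + 1 by omega) w) (by simp) s
    have h2 : (show (Fin (m + 1) → E) →L[ℝ] ℝ from (legendreOstrogradsky L w).snd) =
        ∑ s : Fin (m + 1), (ostrogradskyMomentum (chartAt E w.base) L s w).comp (B s) := rfl
    simp only [hB] at h2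
    rw [h2]
    ext v
    simp [momentumForm_apply]
  rw [h1, momentumForm_eq_comp hφ hc hL hw hs, ContinuousLinearMap.comp_assoc,
    ← coordsDeriv_eq_comp hφ hc (by simpa using hw) (by simp)]

theorem momentumCoord_legendreOstrogradsky (hφ : φ ∈ IsManifold.maximalAtlas 𝓘(ℝ, E) ∞ Q)
    (hL : ContMDiff 𝓘(ℝ, Fin (m + 1 + 1) → E) 𝓘(ℝ, ℝ) ∞ L)
    {w : Jet E Q (2 * m + 1)} (hw : w.base ∈ φ.source) (i : Fin (m + 1)) :
    momentumCoord φ i (legendreOstrogradsky L w) = ostrogradskyMomentum φ L i w := by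
  have hp : (proj (show m ≤ 2 * m + 1 by omega) w).base ∈ φ.source := by simpa using hw
  have h1 : momentumCoord φ i (legendreOstrogradsky L w) =
      ((show (Fin (m + 1) → E) →L[ℝ] ℝ from (legendreOstrogradsky L w).snd).comp
        (coordsDeriv φ (proj (show m ≤ 2 * m + 1 by omega) w)).inverse).comp
        (ContinuousLinearMap.single ℝ (fun _ : Fin (m + 1) => E) i) := rfl
  obtain ⟨A, hA⟩ := exists_equiv_coordsDeriv hφ hp
  rw [h1, legendreOstrogradsky_snd hφ hL hw, hA, ContinuousLinearMap.inverse_equiv]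
  ext x
  simp only [ContinuousLinearMap.comp_apply, ContinuousLinearEquiv.coe_coe,
    ContinuousLinearEquiv.apply_symm_apply, momentumForm_apply]
  rw [Finset.sum_eq_single i]
  · simp
  · intro j _ hj
    simp [hj]
  · simp

/-- The energy in the natural coordinates induced by an arbitrary chart. -/
theorem energy_eq (hφ : φ ∈ IsManifold.maximalAtlas 𝓘(ℝ, E) ∞ Q)
    (hL : ContMDiff 𝓘(ℝ, Fin (m + 1 + 1) → E) 𝓘(ℝ, ℝ) ∞ L)
    {w : Jet E Q (2 * m + 1)} (hw : w.base ∈ φ.source) :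
    energy L w = momentumForm φ L w (velocityCoords φ w) -
      L (proj (show m + 1 ≤ 2 * m + 1 by omega) w) := by
  have hc : chartAt E w.base ∈ IsManifold.maximalAtlas 𝓘(ℝ, E) ∞ Q :=
    IsManifold.chart_mem_maximalAtlas _
  have hs := mem_chart_source E w.base
  -- The covector and the velocity transform contragrediently, so their pairing is the one in the
  -- preferred chart.
  rw [momentumForm_eq_comp hφ hc hL hw hs, ContinuousLinearMap.comp_apply,
    fderiv_velocityCoords hφ hc hw hs, momentumForm_apply]
  rfl

/-- The chart in the definition of `energy` varies with the point; `energy_eq` allows it to be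
frozen near `w`. -/
theorem contMDiff_energy (hL : ContMDiff 𝓘(ℝ, Fin (m + 1 + 1) → E) 𝓘(ℝ, ℝ) ∞ L) :
    ContMDiff 𝓘(ℝ, Fin (2 * m + 1 + 1) → E) 𝓘(ℝ, ℝ) ∞ (energy L) := by
  intro w
  have hc : chartAt E w.base ∈ IsManifold.maximalAtlas 𝓘(ℝ, E) ∞ Q :=
    IsManifold.chart_mem_maximalAtlas _
  have hs := mem_chart_source E w.base
  have h1 : ContMDiffAt 𝓘(ℝ, Fin (2 * m + 1 + 1) → E) 𝓘(ℝ, Fin (m + 1) → E) ∞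
      (velocityCoords (chartAt E w.base) : Jet E Q (2 * m + 1) → Fin (m + 1) → E) w := by
    have hρ : ContDiff ℝ ∞ (fun (v : Fin (2 * m + 1 + 1) → E) (s : Fin (m + 1)) =>
        v ⟨s + 1, by omega⟩) := contDiff_pi.2 fun i => contDiff_apply _ _ _
    exact hρ.contDiffAt.contMDiffAt.comp w (contMDiffAt_coords hc hs)
  have h2 : ContMDiffAt 𝓘(ℝ, Fin (2 * m + 1 + 1) → E) 𝓘(ℝ, ℝ) ∞
      (fun w' => L (proj (show m + 1 ≤ 2 * m + 1 by omega) w')) w :=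
    hL.contMDiffAt.comp w (contMDiffAt_proj _ w)
  refine (((contMDiffAt_momentumForm hc hL hs).clm_apply h1).sub h2).congr_of_eventuallyEq ?_
  filter_upwards [eventually_base_mem (chartAt E w.base).open_source hs] with y hy
  exact energy_eq hc hL hy

/-- At `α = leg_L(w)` the arguments `(q_(0), …, q_(k-1), q̃_(k))` of `L` are therefore the
coordinates of the `k`-jet of `w`. -/
theorem snoc_coords_proj (hφ : φ ∈ IsManifold.maximalAtlas 𝓘(ℝ, E) ∞ Q)
    {w : Jet E Q (2 * m + 1)} (hw : w.base ∈ φ.source) :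
    (Fin.snoc (coords φ (proj (show m ≤ 2 * m + 1 by omega) w))
      (coords φ w ⟨m + 1, by omega⟩) : Fin (m + 1 + 1) → E) =
      coords φ (proj (show m + 1 ≤ 2 * m + 1 by omega) w) := by
  funext i
  refine Fin.lastCases ?_ (fun j => ?_) i
  · rw [Fin.snoc_last, coords_proj hφ _ hw]
    rfl
  · rw [Fin.snoc_castSucc, coords_proj hφ _ hw, coords_proj hφ _ hw]
    rfl

theorem hasOstrogradskyForm_energy (hL : ContMDiff 𝓘(ℝ, Fin (m + 1 + 1) → E) 𝓘(ℝ, ℝ) ∞ L)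
    (hreg : IsHyperregular L) (hφ : φ ∈ IsManifold.maximalAtlas 𝓘(ℝ, E) ∞ Q) :
    HasOstrogradskyForm hreg φ (energy L ∘ hreg.leg.symm) := by
  intro α hα
  obtain ⟨w, rfl⟩ : ∃ w, hreg.leg w = α := hreg.leg.surjective α
  have hw : w.base ∈ φ.source := by
    rw [hreg.leg_apply] at hα
    simpa [legendreOstrogradsky] using hα
  have hproj : (hreg.leg w).proj = proj (show m ≤ 2 * m + 1 by omega) w := by
    rw [hreg.leg_apply]; rfl
  simp only [Function.comp_apply, Diffeomorph.symm_apply_apply]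
  rw [hproj, snoc_coords_proj hφ hw, ofCoords_coords hφ (by simpa using hw), energy_eq hφ hL hw,
    momentumForm_apply, Fin.sum_univ_castSucc, hreg.leg_apply]
  simp only [momentumCoord_legendreOstrogradsky hφ hL hw]
  congr 2
  refine Finset.sum_congr rfl fun j _ => ?_
  rw [coords_proj hφ _ hw]
  rfl

/-- Only `j = 0` survives in the top momentum. The resulting equation `p^(k-1) = ∂L/∂q_(k)` is the
stationarity condition in the envelope formula. -/
theorem ostrogradskyMomentum_last (w : Jet E Q (2 * m + 1)) :
    ostrogradskyMomentum φ L (Fin.last m) w =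
      partialDeriv φ (Fin.last (m + 1)) L (proj (show m + 1 ≤ 2 * m + 1 by omega) w) := by
  rw [ostrogradskyMomentum]
  have h1 : m + 1 - (Fin.last m : ℕ) = 1 := by simp
  rw [Fintype.sum_eq_single (⟨0, by omega⟩ : Fin (m + 1 - (Fin.last m : ℕ)))]
  · rw [pow_zero, one_smul]
    rfl
  · intro j hj
    exact absurd (Fin.ext (by simp only; omega)) hj

theorem momentumCoord_chartAt {r : ℕ} (α : Cotangent (Fin (r + 1) → E) (Jet E Q r))
    (i : Fin (r + 1)) : momentumCoord (chartAt E α.proj.base) i α =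
      (show (Fin (r + 1) → E) →L[ℝ] ℝ from α.snd).comp
        (ContinuousLinearMap.single ℝ (fun _ : Fin (r + 1) => E) i) := by
  have h1 : momentumCoord (chartAt E α.proj.base) i α =
      ((show (Fin (r + 1) → E) →L[ℝ] ℝ from α.snd).comp
        (coordsDeriv (chartAt E α.proj.base) α.proj).inverse).comp
        (ContinuousLinearMap.single ℝ (fun _ : Fin (r + 1) => E) i) := rfl
  rw [h1, coordsDeriv_chartAt, ContinuousLinearMap.inverse_id, ContinuousLinearMap.comp_id]

theorem immersion_proj (w : Jet E Q (2 * m + 1)) :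
    immersion E Q m (proj (show m + 1 ≤ 2 * m + 1 by omega) w) =
      ⟨proj (show m ≤ 2 * m + 1 by omega) w, velocityCoords (chartAt E w.base) w⟩ := by
  have h1 : proj (show m + 1 ≤ 2 * m + 1 by omega) w = mk (m + 1) w.rep := by
    conv_lhs => rw [← mk_rep w]
    rfl
  have h2 : proj (show m ≤ 2 * m + 1 by omega) w = lift m w.rep 0 := by
    conv_lhs => rw [← lift_rep_zero w, proj_lift]
  rw [h1, immersion_mk, h2, rep_zero]
  rfl

theorem isHigherOrderHamiltonian_energy [FiniteDimensional ℝ E]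
    (hL : ContMDiff 𝓘(ℝ, Fin (m + 1 + 1) → E) 𝓘(ℝ, ℝ) ∞ L) (hreg : IsHyperregular L) :
    IsHigherOrderHamiltonian (energy L ∘ hreg.leg.symm) := by
  rintro _ ⟨α, rfl⟩
  obtain ⟨w, rfl⟩ : ∃ w, hreg.leg w = α := hreg.leg.surjective α
  -- The holonomic lift is found by truncating `w = leg_L⁻¹(α)` to order `k`.
  refine ⟨proj (show m + 1 ≤ 2 * m + 1 by omega) w, ?_⟩
  rw [immersion_proj, hreg.leg_apply]
  set x : Jet E Q m := proj (show m ≤ 2 * m + 1 by omega) w with hx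
  have hxw : x.base = w.base := by simp [hx]
  have hφ : chartAt E w.base ∈ IsManifold.maximalAtlas 𝓘(ℝ, E) ∞ Q :=
    IsManifold.chart_mem_maximalAtlas _
  set φ := chartAt E w.base with hφdef
  have hw : w.base ∈ φ.source := mem_chart_source E w.base
  have hxφ : x.base ∈ φ.source := by rw [hxw]; exact hw
  let β : (Fin (m + 1) → E) →L[ℝ] ℝ := (legendreOstrogradsky L w).snd
  -- `u` is `q̃_(k)` restricted to the fiber over `x`, and `g` is `L` as a function of `q_(k)` with
  -- the lower coordinates fixed at those of `x`.
  let u : ((Fin (m + 1) → E) →L[ℝ] ℝ) → E := fun δ =>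
    coords φ (hreg.leg.symm (⟨x, δ⟩ : Cotangent (Fin (m + 1) → E) (Jet E Q m))) ⟨m + 1, by omega⟩
  let q : Fin (m + 1) → E := coords φ x
  let g : E → ℝ := fun e => L (ofCoords φ (Fin.snoc q e))
  have hβ : hreg.leg.symm (⟨x, β⟩ : Cotangent (Fin (m + 1) → E) (Jet E Q m)) = w := by
    have : (⟨x, β⟩ : Cotangent (Fin (m + 1) → E) (Jet E Q m)) = hreg.leg w :=
      (hreg.leg_apply w).symm
    rw [this, Diffeomorph.symm_apply_apply]
  have huβ : u β = coords φ w ⟨m + 1, by omega⟩ := by simp only [u, hβ]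
  have hsnoc : (Fin.snoc q (u β) : Fin (m + 1 + 1) → E) =
      coords φ (proj (show m + 1 ≤ 2 * m + 1 by omega) w) := by
    rw [huβ]
    exact snoc_coords_proj hφ hw
  have hcoord : ∀ (δ : (Fin (m + 1) → E) →L[ℝ] ℝ) (i : Fin (m + 1)),
      momentumCoord φ i (⟨x, δ⟩ : Cotangent (Fin (m + 1) → E) (Jet E Q m)) =
        δ.comp (ContinuousLinearMap.single ℝ (fun _ : Fin (m + 1) => E) i) := by
    intro δ i
    rw [hφdef, ← hxw]
    exact momentumCoord_chartAt (⟨x, δ⟩ : Cotangent (Fin (m + 1) → E) (Jet E Q m)) i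
  have hu : DifferentiableAt ℝ u β := by
    have h1 : ContMDiffAt 𝓘(ℝ, (Fin (m + 1) → E) →L[ℝ] ℝ) 𝓘(ℝ, Fin (2 * m + 1 + 1) → E) ∞
        (fun δ : (Fin (m + 1) → E) →L[ℝ] ℝ => coords φ (hreg.leg.symm
          (⟨x, δ⟩ : Cotangent (Fin (m + 1) → E) (Jet E Q m)))) β := by
      refine ContMDiffAt.comp (g := (coords φ : Jet E Q (2 * m + 1) → _)) β ?_
        (hreg.leg.symm.contMDiff.contMDiffAt.comp β (contMDiff_cotangent_mk x β))
      rw [hβ]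
      exact contMDiffAt_coords hφ hw
    exact differentiableAt_pi.1 ((contMDiffAt_iff_contDiffAt.1 h1).differentiableAt (by simp)) _
  have hg : HasFDerivAt g (β.comp (ContinuousLinearMap.single ℝ (fun _ : Fin (m + 1) => E)
      (Fin.last m))) (u β) := by
    have h1 : HasFDerivAt (L ∘ ofCoords φ) (fderiv ℝ (L ∘ ofCoords φ)
        (coords φ (proj (show m + 1 ≤ 2 * m + 1 by omega) w))) (Fin.snoc q (u β)) := by
      rw [hsnoc]
      exact ((contDiffAt_comp_ofCoords hφ (by simpa using hw)
        hL.contMDiffAt).differentiableAt (by simp)).hasFDerivAt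
    have h2 := h1.comp (u β) (hasFDerivAt_snoc q (u β))
    refine h2.congr_fderiv ?_
    rw [← hcoord β]
    exact ((momentumCoord_legendreOstrogradsky hφ hL hw (Fin.last m)).trans
      (ostrogradskyMomentum_last w)).symm
  -- The local expression over `x` puts `H` in Legendre form: the base point, hence `q_(0), …,
  -- q_(k-1)`, is constant along the fiber, and only `u` varies.
  have hH : (fun δ : (Fin (m + 1) → E) →L[ℝ] ℝ => (energy L ∘ hreg.leg.symm)
      (⟨x, δ⟩ : Cotangent (Fin (m + 1) → E) (Jet E Q m))) =
      fun δ => δ ((Fin.snoc (fun j : Fin m => q j.succ) 0 : Fin (m + 1) → E) +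
        ContinuousLinearMap.single ℝ (fun _ : Fin (m + 1) => E) (Fin.last m) (u δ)) - g (u δ) := by
    funext δ
    have h1 := hasOstrogradskyForm_energy hL hreg hφ
      (⟨x, δ⟩ : Cotangent (Fin (m + 1) → E) (Jet E Q m)) hxφ
    refine h1.trans ?_
    simp only [hcoord]
    rw [← snoc_eq_add_single]
    rw [apply_snoc]
    rfl
  have hvel : velocityCoords φ w = (Fin.snoc (fun j : Fin m => q j.succ) 0 : Fin (m + 1) → E) +
        ContinuousLinearMap.single ℝ (fun _ : Fin (m + 1) => E) (Fin.last m) (u β) := by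
    rw [← snoc_eq_add_single, huβ]
    funext i
    refine Fin.lastCases ?_ (fun j => ?_) i
    · rw [Fin.snoc_last]; rfl
    · rw [Fin.snoc_castSucc]
      simp only [q, hx]
      rw [coords_proj hφ _ hw]
      rfl
  have hfd : fderiv ℝ (fun δ : StrongDual ℝ (Fin (m + 1) → E) => (energy L ∘ hreg.leg.symm)
      (⟨x, δ⟩ : Cotangent (Fin (m + 1) → E) (Jet E Q m))) β =
      bidualEquiv (Fin (m + 1) → E) (velocityCoords φ w) := by
    rw [hvel]
    refine Eq.trans ?_ (hasFDerivAt_legendre hu _ _ hg).fderiv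
    exact congrArg (fun f => fderiv ℝ f β) hH
  have hvec : velocityCoords φ w = (bidualEquiv (Fin (m + 1) → E)).symm
      (fderiv ℝ (fun δ : StrongDual ℝ (Fin (m + 1) → E) => (energy L ∘ hreg.leg.symm)
      (⟨x, δ⟩ : Cotangent (Fin (m + 1) → E) (Jet E Q m))) β) := by
    rw [hfd, LinearEquiv.symm_apply_apply]
  exact congrArg (fun v : Fin (m + 1) → E =>
    (⟨x, v⟩ : TangentBundle 𝓘(ℝ, Fin (m + 1) → E) (Jet E Q m))) hvec

end LegendreOstrogradsky

end HigherOrder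

theorem mainTheorem7 {E : Type*} [NormedAddCommGroup E] [NormedSpace ℝ E] [FiniteDimensional ℝ E]
    {Q : Type*} [TopologicalSpace Q] [T2Space Q] [SecondCountableTopology Q] [ChartedSpace E Q]
    [IsManifold 𝓘(ℝ, E) ∞ Q] (m : ℕ) (L : HigherOrder.Jet E Q (m + 1) → ℝ)
    (hL : ContMDiff 𝓘(ℝ, Fin (m + 1 + 1) → E) 𝓘(ℝ, ℝ) ∞ L)
    (hreg : HigherOrder.IsHyperregular L) :
    ∃ H : HigherOrder.Cotangent (Fin (m + 1) → E) (HigherOrder.Jet E Q m) → ℝ,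
      H = HigherOrder.energy L ∘ hreg.leg.symm ∧
      ContMDiff (𝓘(ℝ, Fin (m + 1) → E).prod 𝓘(ℝ, (Fin (m + 1) → E) →L[ℝ] ℝ)) 𝓘(ℝ, ℝ) ∞ H ∧
      (∀ φ ∈ IsManifold.maximalAtlas 𝓘(ℝ, E) ∞ Q, HigherOrder.HasOstrogradskyForm hreg φ H) ∧
      HigherOrder.IsHigherOrderHamiltonian H ∧
      (∀ H' : HigherOrder.Cotangent (Fin (m + 1) → E) (HigherOrder.Jet E Q m) → ℝ,
        H' ∘ HigherOrder.legendreOstrogradsky L = HigherOrder.energy L → H' = H) ∧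
      (∀ H' : HigherOrder.Cotangent (Fin (m + 1) → E) (HigherOrder.Jet E Q m) → ℝ,
        (∀ φ ∈ atlas E Q, HigherOrder.HasOstrogradskyForm hreg φ H') → H' = H) := by
  have hform := fun φ (hφ : φ ∈ IsManifold.maximalAtlas 𝓘(ℝ, E) ∞ Q) =>
    HigherOrder.hasOstrogradskyForm_energy hL hreg hφ
  refine ⟨_, rfl, (HigherOrder.contMDiff_energy hL).comp hreg.leg.symm.contMDiff, hform,
    HigherOrder.isHigherOrderHamiltonian_energy hL hreg, fun H' hH' => ?_, fun H' hH' => ?_⟩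
  · funext α
    rw [← hH', Function.comp_apply, Function.comp_apply, ← hreg.leg_apply,
      Diffeomorph.apply_symm_apply]
  -- The expression in the preferred chart at the base point of `α` has a right-hand side that does
  -- not involve the function, so it fixes the value at `α`.
  · funext α
    have hs := mem_chart_source E α.proj.base
    exact (hH' _ (chart_mem_atlas E _) α hs).trans
      (hform _ (IsManifold.chart_mem_maximalAtlas _) α hs).symm
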